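/- Let $N$ be a nonnegative integer and $\varepsilon>0$. For a symmetric real matrix $Q=(q_{ij})_{i,j=1}^N$ with $|q_{ij}|<1$ put $q=\max_{i,j}|q_{ij}|$ (with $q=0$ if $N=0$), $R=R(Q)=\frac{2+\varepsilon}{1-q}$ and $$\pi(q,N)=\frac{qN^2(3+\varepsilon)^2}{1-q\,(3-2q+(3+\varepsilon)^2N^2)} .$$ Let $\mathcal F_Q$ be the completion of $\bigoplus_{n\ge 0}(\mathbb C^N)^{\otimes n}$ for the inner product $$\langle e_{i_1}\otimes\cdots\otimes e_{i_m},\,e_{j_1}\otimes\cdots\otimes e_{j_n}\rangle_Q=\delta_{m,n}\sum_{\sigma\in S_n}\ \prod_{a<b,\ \sigma(a)>\sigma(b)}q_{j_aj_b}\ \prod_{k=1}^n\delta_{i_k,\,j_{\sigma^{-1}(k)}},$$ with vacuum vector $\Omega$ (the unit of the summand $n=0$). Let $l_i$ be the left creation operators $l_i\eta=e_i\otimes\eta$, let $X_i=l_i+l_i^*$ $(1\le i\le N)$ be the mixed $q$-Gaussian variables, $\Gamma_Q$ the von Neumann algebra they generate, and $\tau_Q(T)=\langle T\Omega,\Omega\rangle_Q$.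 For a noncommutative power series $F=\sum_w F_wY_w$ in $Y_1,\dots,Y_N$ (sum over words $w$) write $\|F\|_r=\sum_w|F_w|\,r^{|w|}$; its radius of convergence is greater than $R$ if $\|F\|_{R'}<\infty$ for some $R'>R$. The variables $Y_i$ are self-adjoint, so that $(cY_{i_1}\cdots Y_{i_n})^*=\bar c\,Y_{i_n}\cdots Y_{i_1}$. Let $\partial_j$ and $D_j$ be the free difference quotient and the cyclic gradient, given on monomials $P$ by $\partial_jP=\sum_{P=AY_jB}A\otimes B$ and $D_jP=\sum_{P=AY_jB}BA$; $D_j$ acts on power series term by term. Elements $\eta_1,\dots,\eta_N$ of $\Gamma_Q$ are the conjugate variables of $X_1,\dots,X_N$ if for every $j$ and every noncommutative polynomial $P$ $$\langle \eta_j,P(X)\rangle_{\tau_Q}=\langle 1\otimes1,\ \partial_jP\rangle_{\tau_Q\otimes\tau_Q^{op}},\qquad\text{i.e.}\qquad \tau_Q(\eta_j^*P(X))=(\tau_Q\otimes\tau_Q)\big((\partial_jP)(X)\big).$$ Call $Q$ admissible if $q\,(3-2q+(3+\varepsilon)^2N^2)<1$ (so that $\pi(q,N)$ has a positive denominator) and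 $\pi(q,N)<1$. Then for every admissible $Q$ one can choose noncommutative power series $\xi_1^Q,\dots,\xi_N^Q$ such that: 1. for every admissible $Q$: $\|X_i\|<R$ for all $i$, each $\xi_j^Q$ has radius of convergence greater than $R$, and $\xi_1^Q(X_1,\dots,X_N),\dots,\xi_N^Q(X_1,\dots,X_N)$ are the conjugate variables of $X_1,\dots,X_N$; 2. for every admissible $Q$ there is a self-adjoint noncommutative power series $V$ with radius of convergence greater than $R$ such that $D_iV=\xi_i^Q$ for $i=1,\dots,N$; 3. for fixed $N$ and $\varepsilon$, $\|\xi_i^Q-Y_i\|_{R(Q)}\to0$ as $q\to0$, uniformly over the admissible $Q$: for every $\eta>0$ there is $\delta>0$ such that $\|\xi_i^Q-Y_i\|_{R(Q)}<\eta$ for all $i$ and all admissible $Q$ with $q<\delta$. -/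

import Mathlib

namespace MixedQ

open scoped ComplexConjugate ENNReal TensorProduct

/-- The index set of the standard basis of the Fock space: a level `n` together with a vector
`(i_1, ..., i_n)` in `{1, ..., N}^n`, standing for `e_{i_1} ⊗ ... ⊗ e_{i_n}` (the vacuum vector
when `n = 0`). -/
abbrev FockIndex (N : ℕ) : Type := Σ n : ℕ, (Fin n → Fin N)

/-- A symmetric real `N × N` matrix `Q = (q_{ij})` with entries in `(-1, 1)`. -/
structure QMatrix (N : ℕ) where
  coef : Matrix (Fin N) (Fin N) ℝ
  symm : coef.IsSymm
  abs_lt_one : ∀ i j, |coef i j| < 1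

variable {N : ℕ}

/-- The coefficient `a(σ, v)`: the product of `q(v_a, v_b)` over the inversions
`a < b`, `σ b < σ a` of the permutation `σ`. -/
noncomputable def invWeight (Q : QMatrix N) {n : ℕ} (σ : Equiv.Perm (Fin n)) (v : Fin n → Fin N) : ℝ :=
  ∏ a, ∏ b, if a < b ∧ σ b < σ a then Q.coef (v a) (v b) else 1

/-- The `Q`-inner product of two basis tensors:
`⟨e_u, e_v⟩_Q = δ_{m,n} ∑_σ a(σ, v) ∏_k ⟨e_{u_k}, e_{v_{σ⁻¹(k)}}⟩`, the product of Kronecker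
deltas being the indicator of `u = v ∘ σ⁻¹`. -/
noncomputable def gram (Q : QMatrix N) (u v : FockIndex N) : ℝ :=
  ∑ σ : Equiv.Perm (Fin v.1),
    if u = ⟨v.1, fun k => v.2 (σ.symm k)⟩ then invWeight Q σ v.2 else 0

theorem QMatrix.coef_comm (Q : QMatrix N) (i j : Fin N) : Q.coef i j = Q.coef j i :=
  (Q.symm.apply i j).symm

theorem gram_ne (Q : QMatrix N) (u v : FockIndex N) (h : u.1 ≠ v.1) : gram Q u v = 0 := by
  unfold gram
  refine Finset.sum_eq_zero fun σ _ => if_neg fun hu => h (by rw [hu])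

theorem gram_level (Q : QMatrix N) {n : ℕ} (u v : Fin n → Fin N) :
    gram Q ⟨n, u⟩ ⟨n, v⟩ = ∑ σ : Equiv.Perm (Fin n),
      if u = v ∘ σ.symm then invWeight Q σ v else 0 := by
  unfold gram
  refine Finset.sum_congr rfl fun σ _ => ?_
  congr 1
  simp [Function.comp_def]

theorem invWeight_symm (Q : QMatrix N) {n : ℕ} (σ : Equiv.Perm (Fin n)) (v : Fin n → Fin N) :
    invWeight Q σ.symm (v ∘ σ.symm) = invWeight Q σ v := by
  unfold invWeight
  rw [← Equiv.prod_comp σ]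
  conv_lhs => enter [2, a]; rw [← Equiv.prod_comp σ]
  rw [Finset.prod_comm]
  refine Finset.prod_congr rfl fun a _ => Finset.prod_congr rfl fun b _ => ?_
  simp only [Function.comp_apply, Equiv.symm_apply_apply]
  rw [Q.coef_comm]
  congr 1
  exact propext and_comm

theorem gram_comm (Q : QMatrix N) (u v : FockIndex N) : gram Q u v = gram Q v u := by
  classical
  by_cases h : u.1 = v.1
  · obtain ⟨n, u⟩ := u
    obtain ⟨m, v⟩ := v
    obtain rfl : n = m := h
    rw [gram_level, gram_level, ← Equiv.sum_comp (Equiv.inv (Equiv.Perm (Fin n)))]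
    refine Finset.sum_congr rfl fun σ _ => ?_
    simp only [Equiv.inv_apply]
    have e : (u = v ∘ (σ⁻¹ : Equiv.Perm (Fin n)).symm) ↔ v = u ∘ σ.symm := by
      constructor
      · rintro rfl; ext k; simp [Equiv.Perm.inv_def]
      · rintro rfl; ext k; simp [Equiv.Perm.inv_def]
    by_cases hv : v = u ∘ σ.symm
    · rw [if_pos (e.2 hv), if_pos hv, hv]
      exact invWeight_symm Q σ u
    · rw [if_neg (fun hu => hv (e.1 hu)), if_neg hv]
  · rw [gram_ne Q u v h, gram_ne Q v u (Ne.symm h)]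

theorem psd_aux {P ι : Type*} [Fintype P] [Fintype ι] [DecidableEq ι] (α β : ι → ℝ)
    (χ : ι → P → ℝ) (hα : ∀ i, 0 ≤ α i) (hβ : ∀ i, 0 ≤ β i) (f : P → ℂ) :
    0 ≤ (∑ ρ, ∑ π, conj (f π) * f ρ *
      ((∏ i, (α i + β i * (χ i ρ * χ i π)) : ℝ) : ℂ)).re := by
  have key : (∑ ρ, ∑ π, conj (f π) * f ρ *
      ((∏ i, (α i + β i * (χ i ρ * χ i π)) : ℝ) : ℂ)) =
      ((∑ t ∈ (Finset.univ : Finset ι).powerset,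
        (∏ i ∈ t, α i) * (∏ i ∈ Finset.univ \ t, β i) *
        Complex.normSq (∑ ρ, f ρ * ((∏ i ∈ Finset.univ \ t, χ i ρ : ℝ) : ℂ)) : ℝ) : ℂ) := by
    push_cast
    simp_rw [Complex.normSq_eq_conj_mul_self, map_sum, Finset.prod_add, Finset.mul_sum,
      Finset.sum_mul, Finset.mul_sum, Finset.prod_mul_distrib]
    rw [Finset.sum_congr rfl fun ρ _ => Finset.sum_comm, Finset.sum_comm]
    refine Finset.sum_congr rfl fun t _ => ?_
    refine Finset.sum_congr rfl fun ρ _ => Finset.sum_congr rfl fun π _ => ?_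
    simp only [map_mul, map_prod, Complex.conj_ofReal]
    ring
  rw [key, Complex.ofReal_re]
  refine Finset.sum_nonneg fun t _ => mul_nonneg (mul_nonneg ?_ ?_) (Complex.normSq_nonneg _)
  · exact Finset.prod_nonneg fun i _ => hα i
  · exact Finset.prod_nonneg fun i _ => hβ i

theorem prod_pairs {n : ℕ} (f : Fin n → Fin n → ℝ) (hf : ∀ x, f x x = 1) :
    ∏ x, ∏ y, f x y = ∏ p : Fin n × Fin n, if p.1 < p.2 then f p.1 p.2 * f p.2 p.1 else 1 := by
  have h1 : ∀ x y, f x y = (if x < y then f x y else 1) * (if y < x then f x y else 1) := by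
    intro x y
    rcases lt_trichotomy x y with h | h | h
    · simp [h, h.le]
    · simp [h, hf]
    · simp [h, h.le]
  rw [Fintype.prod_prod_type]
  calc ∏ x, ∏ y, f x y
      = (∏ x, ∏ y, if x < y then f x y else 1) * ∏ x, ∏ y, if y < x then f x y else 1 := by
        simp_rw [← Finset.prod_mul_distrib, ← h1]
    _ = (∏ x, ∏ y, if x < y then f x y else 1) * ∏ x, ∏ y, if x < y then f y x else 1 := by
        congr 1
        rw [Finset.prod_comm]
    _ = _ := by
        simp_rw [← Finset.prod_mul_distrib]
        refine Finset.prod_congr rfl fun x _ => Finset.prod_congr rfl fun y _ => ?_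
        split_ifs <;> simp

theorem gram_level_nonneg (Q : QMatrix N) (n : ℕ) (c : (Fin n → Fin N) → ℂ) :
    0 ≤ (∑ u, ∑ v, conj (c u) * c v * (gram Q ⟨n, u⟩ ⟨n, v⟩ : ℂ)).re := by
  -- the two-permutation kernel attached to a fixed word
  let K : (Fin n → Fin N) → Equiv.Perm (Fin n) → Equiv.Perm (Fin n) → ℝ := fun w ρ π =>
    ∏ x, ∏ y, if ρ.symm x < ρ.symm y ∧ π.symm y < π.symm x then Q.coef (w x) (w y) else 1
  have hK : ∀ w ρ π, invWeight Q (π⁻¹ * ρ) (w ∘ ρ) = K w ρ π := by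
    intro w ρ π
    simp only [invWeight, K]
    symm
    rw [← Equiv.prod_comp ρ]
    refine Finset.prod_congr rfl fun a _ => ?_
    rw [← Equiv.prod_comp ρ]
    refine Finset.prod_congr rfl fun b _ => ?_
    simp [Equiv.Perm.inv_def]
    congr
  have hS : (∑ u, ∑ v, conj (c u) * c v * (gram Q ⟨n, u⟩ ⟨n, v⟩ : ℂ)) =
      ∑ v, ∑ σ : Equiv.Perm (Fin n), conj (c (v ∘ σ.symm)) * c v * (invWeight Q σ v : ℂ) := by
    rw [Finset.sum_comm]
    refine Finset.sum_congr rfl fun v _ => ?_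
    simp_rw [gram_level]
    push_cast
    simp_rw [Finset.mul_sum]
    rw [Finset.sum_comm]
    refine Finset.sum_congr rfl fun σ _ => ?_
    rw [Finset.sum_eq_single (v ∘ σ.symm)]
    · simp
    · intro b _ hb
      simp [hb]
    · simp
  have hav : (Fintype.card (Equiv.Perm (Fin n)) : ℂ) *
      (∑ u, ∑ v, conj (c u) * c v * (gram Q ⟨n, u⟩ ⟨n, v⟩ : ℂ)) =
      ∑ w : Fin n → Fin N, ∑ ρ : Equiv.Perm (Fin n), ∑ π : Equiv.Perm (Fin n),
        conj (c (w ∘ π)) * c (w ∘ ρ) * (K w ρ π : ℂ) := by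
    refine Eq.trans ?_ Finset.sum_comm
    rw [hS, ← nsmul_eq_mul, ← Finset.card_univ, ← Finset.sum_const]
    refine Finset.sum_congr rfl fun ρ _ => ?_
    rw [← Equiv.sum_comp (Equiv.arrowCongr ρ.symm (Equiv.refl (Fin N)))]
    refine Finset.sum_congr rfl fun w _ => ?_
    rw [← Equiv.sum_comp ((Equiv.inv (Equiv.Perm (Fin n))).trans (Equiv.mulRight ρ))]
    refine Finset.sum_congr rfl fun π _ => ?_
    have e1 : (Equiv.arrowCongr ρ.symm (Equiv.refl (Fin N))) w = w ∘ ρ := by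
      ext k; simp [Equiv.arrowCongr]
    have e2 : ((Equiv.inv (Equiv.Perm (Fin n))).trans (Equiv.mulRight ρ)) π = π⁻¹ * ρ := rfl
    rw [e1, e2, hK]
    have e3 : (w ∘ ρ) ∘ (π⁻¹ * ρ).symm = w ∘ π := by
      ext k
      have : (π⁻¹ * ρ).symm k = ρ.symm (π k) := by
        rw [Equiv.symm_apply_eq]; simp [Equiv.Perm.inv_def]
      simp [this]
    rw [e3]
  have hpos : 0 ≤ ((Fintype.card (Equiv.Perm (Fin n)) : ℂ) *
      (∑ u, ∑ v, conj (c u) * c v * (gram Q ⟨n, u⟩ ⟨n, v⟩ : ℂ))).re := by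
    rw [hav, Complex.re_sum]
    refine Finset.sum_nonneg fun w _ => ?_
    have hKp : ∀ ρ π, K w ρ π = ∏ p : Fin n × Fin n,
        ((if p.1 < p.2 then (1 + Q.coef (w p.1) (w p.2)) / 2 else 1) +
          (if p.1 < p.2 then (1 - Q.coef (w p.1) (w p.2)) / 2 else 0) *
          ((if ρ.symm p.1 < ρ.symm p.2 then 1 else -1) *
            (if π.symm p.1 < π.symm p.2 then 1 else -1))) := by
      intro ρ π
      simp only [K]
      rw [prod_pairs _ (by simp)]
      refine Finset.prod_congr rfl fun p _ => ?_
      by_cases hp : p.1 < p.2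
      · have hρ : ¬ ρ.symm p.1 < ρ.symm p.2 ↔ ρ.symm p.2 < ρ.symm p.1 := by
          rw [not_lt]
          exact (lt_iff_le_and_ne.trans (and_iff_left fun h =>
            hp.ne' (ρ.symm.injective h))).symm
        have hπ : ¬ π.symm p.1 < π.symm p.2 ↔ π.symm p.2 < π.symm p.1 := by
          rw [not_lt]
          exact (lt_iff_le_and_ne.trans (and_iff_left fun h =>
            hp.ne' (π.symm.injective h))).symm
        simp only [if_pos hp, ← hρ, ← hπ]
        rw [Q.coef_comm (w p.2) (w p.1)]
        by_cases h1 : ρ.symm p.1 < ρ.symm p.2 <;> by_cases h2 : π.symm p.1 < π.symm p.2 <;>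
          simp [h1, h2] <;> ring
      · simp [hp]
    simp_rw [hKp]
    refine psd_aux _ _ (fun (p : Fin n × Fin n) (ρ : Equiv.Perm (Fin n)) =>
      if ρ.symm p.1 < ρ.symm p.2 then (1 : ℝ) else -1) ?_ ?_ (fun ρ => c (w ∘ ρ))
    · intro p
      have := abs_lt.1 (Q.abs_lt_one (w p.1) (w p.2))
      split_ifs <;> linarith
    · intro p
      have := abs_lt.1 (Q.abs_lt_one (w p.1) (w p.2))
      split_ifs <;> linarith
  have hcard : (0 : ℝ) < (Fintype.card (Equiv.Perm (Fin n)) : ℝ) := by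
    exact_mod_cast Fintype.card_pos
  rw [show (Fintype.card (Equiv.Perm (Fin n)) : ℂ) =
    ((Fintype.card (Equiv.Perm (Fin n)) : ℝ) : ℂ) by push_cast; rfl, Complex.re_ofReal_mul] at hpos
  exact nonneg_of_mul_nonneg_right hpos hcard


/-- The permutation of `n + 1` points that sends `k` to `0` and acts as `τ` between the remaining
points, identified with `n` points in an order-preserving way. -/
def consPerm {n : ℕ} (k : Fin (n + 1)) (τ : Equiv.Perm (Fin n)) : Equiv.Perm (Fin (n + 1)) :=
  (finSuccEquiv' k).trans ((Equiv.optionCongr τ).trans (finSuccEquiv' 0).symm)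

theorem consPerm_self {n : ℕ} (k : Fin (n + 1)) (τ : Equiv.Perm (Fin n)) :
    consPerm k τ k = 0 := by
  simp [consPerm]

theorem consPerm_succAbove {n : ℕ} (k : Fin (n + 1)) (τ : Equiv.Perm (Fin n)) (a : Fin n) :
    consPerm k τ (k.succAbove a) = (τ a).succ := by
  simp [consPerm]

theorem consPerm_symm_zero {n : ℕ} (k : Fin (n + 1)) (τ : Equiv.Perm (Fin n)) :
    (consPerm k τ).symm 0 = k := by
  rw [Equiv.symm_apply_eq, consPerm_self]

theorem consPerm_symm_succ {n : ℕ} (k : Fin (n + 1)) (τ : Equiv.Perm (Fin n)) (b : Fin n) :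
    (consPerm k τ).symm b.succ = k.succAbove (τ.symm b) := by
  rw [Equiv.symm_apply_eq, consPerm_succAbove, Equiv.apply_symm_apply]

theorem consPerm_bijective (n : ℕ) :
    Function.Bijective (fun p : Fin (n + 1) × Equiv.Perm (Fin n) => consPerm p.1 p.2) := by
  rw [Fintype.bijective_iff_injective_and_card]
  constructor
  · rintro ⟨k, τ⟩ ⟨k', τ'⟩ h
    simp only at h
    have hk : k = k' := by
      rw [← consPerm_symm_zero k τ, h, consPerm_symm_zero]
    subst hk
    have : τ = τ' := by
      ext a
      have := congrArg (fun e => e (k.succAbove a)) h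
      simp only [consPerm_succAbove] at this
      rw [Fin.succ_injective n this]
    rw [this]
  · simp [Fintype.card_perm, Nat.factorial_succ]

theorem invWeight_consPerm (Q : QMatrix N) {n : ℕ} (k : Fin (n + 1)) (τ : Equiv.Perm (Fin n))
    (v : Fin (n + 1) → Fin N) :
    invWeight Q (consPerm k τ) v =
      (∏ l, if l < k then Q.coef (v k) (v l) else 1) * invWeight Q τ (v ∘ k.succAbove) := by
  unfold invWeight
  rw [Fin.prod_univ_succAbove _ k]
  rw [Finset.prod_eq_one (by intro b _; simp [consPerm_self]), one_mul]
  rw [Fin.prod_univ_succAbove (fun l => if l < k then Q.coef (v k) (v l) else 1) k]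
  rw [if_neg (lt_irrefl k), one_mul, ← Finset.prod_mul_distrib]
  refine Finset.prod_congr rfl fun a _ => ?_
  rw [Fin.prod_univ_succAbove _ k]
  congr 1
  · simp [consPerm_self, consPerm_succAbove, Q.coef_comm (v k)]
  · refine Finset.prod_congr rfl fun b _ => ?_
    simp [consPerm_succAbove, (Fin.strictMono_succAbove k).lt_iff_lt]

theorem gram_cons (Q : QMatrix N) {n : ℕ} (i : Fin N) (u : Fin n → Fin N)
    (v : Fin (n + 1) → Fin N) :
    gram Q ⟨n + 1, Fin.cons i u⟩ ⟨n + 1, v⟩ = ∑ k : Fin (n + 1),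
      if v k = i then (∏ l, if l < k then Q.coef i (v l) else 1) *
        gram Q ⟨n, u⟩ ⟨n, v ∘ k.succAbove⟩ else 0 := by
  rw [gram_level, ← (Equiv.ofBijective _ (consPerm_bijective n)).sum_comp, Fintype.sum_prod_type]
  refine Finset.sum_congr rfl fun k _ => ?_
  have e : ∀ τ : Equiv.Perm (Fin n), ((Fin.cons i u : Fin (n + 1) → Fin N) =
      v ∘ (consPerm k τ).symm) ↔ v k = i ∧ u = (v ∘ k.succAbove) ∘ τ.symm := by
    intro τ
    rw [funext_iff, Fin.forall_fin_succ, funext_iff]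
    simp [consPerm_symm_zero, consPerm_symm_succ, eq_comm]
  simp only [Equiv.ofBijective_apply, e]
  by_cases h : v k = i
  · simp only [h, true_and, if_true]
    rw [gram_level, Finset.mul_sum]
    refine Finset.sum_congr rfl fun τ _ => ?_
    rw [invWeight_consPerm, h, mul_ite, mul_zero]
  · simp [h]

/-- The algebraic Fock space: finite linear combinations of the basis tensors. It carries the
semi-inner product determined by `Q`. -/
def PreFock (_Q : QMatrix N) : Type := FockIndex N →₀ ℂ

noncomputable instance (Q : QMatrix N) : AddCommGroup (PreFock Q) :=
  inferInstanceAs (AddCommGroup (FockIndex N →₀ ℂ))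

noncomputable instance (Q : QMatrix N) : Module ℂ (PreFock Q) :=
  inferInstanceAs (Module ℂ (FockIndex N →₀ ℂ))

/-- The sesquilinear extension of `gram` (conjugate linear in the first variable, as in
Mathlib). -/
noncomputable def fockForm (Q : QMatrix N) (x y : FockIndex N →₀ ℂ) : ℂ :=
  x.sum fun u a => y.sum fun v b => conj a * b * (gram Q u v : ℂ)

theorem fockForm_self_nonneg (Q : QMatrix N) (x : FockIndex N →₀ ℂ) :
    0 ≤ (fockForm Q x x).re := by
  classical
  let S : Finset ℕ := x.support.image Sigma.fst
  let T : Finset (FockIndex N) := S.sigma fun n => (Finset.univ : Finset (Fin n → Fin N))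
  have hT : x.support ⊆ T := by
    intro u hu
    simp only [T, Finset.mem_sigma, Finset.mem_univ, and_true]
    exact Finset.mem_image_of_mem _ hu
  have h1 : fockForm Q x x = ∑ u ∈ T, ∑ v ∈ T, conj (x u) * x v * (gram Q u v : ℂ) := by
    unfold fockForm
    rw [Finsupp.sum_of_support_subset _ hT _ (by intro u _; simp [Finsupp.sum])]
    refine Finset.sum_congr rfl fun u _ => ?_
    rw [Finsupp.sum_of_support_subset _ hT _ (by intro u _; simp)]
  rw [h1, Finset.sum_sigma, Complex.re_sum]
  refine Finset.sum_nonneg fun n hn => ?_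
  have h2 : ∀ u : Fin n → Fin N, (∑ v ∈ T, conj (x ⟨n, u⟩) * x v * (gram Q ⟨n, u⟩ v : ℂ)) =
      ∑ v : Fin n → Fin N, conj (x ⟨n, u⟩) * x ⟨n, v⟩ * (gram Q ⟨n, u⟩ ⟨n, v⟩ : ℂ) := by
    intro u
    rw [Finset.sum_sigma, Finset.sum_eq_single_of_mem n hn]
    intro m _ hm
    refine Finset.sum_eq_zero fun v _ => ?_
    rw [gram_ne Q _ _ (by exact hm.symm)]
    simp
  simp_rw [h2]
  exact gram_level_nonneg Q n (fun u => x ⟨n, u⟩)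

theorem fockForm_conj (Q : QMatrix N) (x y : FockIndex N →₀ ℂ) :
    conj (fockForm Q y x) = fockForm Q x y := by
  unfold fockForm
  rw [Finsupp.sum_comm]
  simp only [map_finsuppSum]
  refine Finsupp.sum_congr fun u _ => Finsupp.sum_congr fun v _ => ?_
  simp only [map_mul, Complex.conj_conj, Complex.conj_ofReal]
  rw [gram_comm Q v u]
  ring

theorem fockForm_add_left (Q : QMatrix N) (x y z : FockIndex N →₀ ℂ) :
    fockForm Q (x + y) z = fockForm Q x z + fockForm Q y z := by
  unfold fockForm
  refine Finsupp.sum_add_index' (fun u => by simp) fun u a b => ?_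
  rw [← Finsupp.sum_add]
  exact Finsupp.sum_congr fun v _ => by rw [map_add]; ring

theorem fockForm_smul_left (Q : QMatrix N) (x y : FockIndex N →₀ ℂ) (r : ℂ) :
    fockForm Q (r • x) y = conj r * fockForm Q x y := by
  unfold fockForm
  refine (Finsupp.sum_smul_index (fun u => by simp)).trans ?_
  rw [Finsupp.mul_sum]
  refine Finsupp.sum_congr fun u _ => ?_
  rw [Finsupp.mul_sum]
  exact Finsupp.sum_congr fun v _ => by rw [map_mul]; ring

noncomputable instance (Q : QMatrix N) : PreInnerProductSpace.Core ℂ (PreFock Q) where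
  inner x y := fockForm Q x y
  conj_inner_symm x y := fockForm_conj Q x y
  re_inner_nonneg x := fockForm_self_nonneg Q x
  add_left x y z := fockForm_add_left Q x y z
  smul_left x y r := fockForm_smul_left Q x y r

noncomputable instance (Q : QMatrix N) : SeminormedAddCommGroup (PreFock Q) :=
  InnerProductSpace.Core.toSeminormedAddCommGroup (𝕜 := ℂ)

noncomputable instance (Q : QMatrix N) : InnerProductSpace ℂ (PreFock Q) :=
  InnerProductSpace.ofCore _

/-- The basis tensor `e_{u_1} ⊗ ... ⊗ e_{u_n}`. -/
noncomputable def PreFock.e (Q : QMatrix N) (u : FockIndex N) : PreFock Q :=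
  (Finsupp.single u (1 : ℂ) : FockIndex N →₀ ℂ)

theorem PreFock.inner_e (Q : QMatrix N) (u v : FockIndex N) :
    inner ℂ (PreFock.e Q u) (PreFock.e Q v) = (gram Q u v : ℂ) := by
  change fockForm Q (Finsupp.single u 1) (Finsupp.single v 1) = _
  unfold fockForm
  rw [Finsupp.sum_single_index (by simp), Finsupp.sum_single_index (by simp)]
  simp

theorem PreFock.induction {Q : QMatrix N} {p : PreFock Q → Prop} (x : PreFock Q) (h0 : p 0)
    (hadd : ∀ x y, p x → p y → p (x + y)) (hs : ∀ (c : ℂ) u, p (c • PreFock.e Q u)) : p x := by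
  refine Finsupp.induction_linear (motive := p) x h0 hadd fun u c => ?_
  have := hs c u
  have e : c • PreFock.e Q u = (Finsupp.single u c : FockIndex N →₀ ℂ) := by
    unfold PreFock.e
    exact (Finsupp.smul_single c u (1 : ℂ)).trans (by simp)
  rwa [e] at this

/-- The linear map with prescribed values on the basis tensors. -/
noncomputable def PreFock.lift {Q : QMatrix N} {M : Type*} [AddCommGroup M] [Module ℂ M]
    (f : FockIndex N → M) : PreFock Q →ₗ[ℂ] M :=
  Finsupp.linearCombination ℂ f

theorem PreFock.lift_e {Q : QMatrix N} {M : Type*} [AddCommGroup M] [Module ℂ M]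
    (f : FockIndex N → M) (u : FockIndex N) : PreFock.lift f (PreFock.e Q u) = f u :=
  (Finsupp.linearCombination_single ℂ (1 : ℂ) u).trans (one_smul ℂ _)

/-- Left creation `e_{j_1} ⊗ ... ⊗ e_{j_n} ↦ e_i ⊗ e_{j_1} ⊗ ... ⊗ e_{j_n}` on the algebraic Fock
space. -/
noncomputable def create (Q : QMatrix N) (i : Fin N) : PreFock Q →ₗ[ℂ] PreFock Q :=
  PreFock.lift fun u => PreFock.e Q ⟨u.1 + 1, Fin.cons i u.2⟩

/-- `∑_k δ_{i, j_k} q_{i j_1} ⋯ q_{i j_{k-1}} e_{j_1} ⊗ ... ⊗ ê_{j_k} ⊗ ... ⊗ e_{j_n}`, where the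
`k`-th factor is omitted. -/
noncomputable def annihilateWord (Q : QMatrix N) (i : Fin N) : FockIndex N → PreFock Q
  | ⟨0, _⟩ => 0
  | ⟨n + 1, v⟩ => ∑ k : Fin (n + 1), if v k = i then
      ((∏ l, if l < k then Q.coef i (v l) else 1 : ℝ) : ℂ) •
        PreFock.e Q ⟨n, v ∘ k.succAbove⟩ else 0

/-- Left annihilation on the algebraic Fock space. -/
noncomputable def annihilate (Q : QMatrix N) (i : Fin N) : PreFock Q →ₗ[ℂ] PreFock Q :=
  PreFock.lift (annihilateWord Q i)

theorem inner_create_left (Q : QMatrix N) (i : Fin N) (x y : PreFock Q) :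
    inner ℂ (create Q i x) y = inner ℂ x (annihilate Q i y) := by
  induction x using PreFock.induction with
  | h0 => simp
  | hadd x x' hx hx' => simp [inner_add_left, hx, hx']
  | hs c u =>
    induction y using PreFock.induction with
    | h0 => simp
    | hadd y y' hy hy' => simp only [map_add, inner_add_right, hy, hy']
    | hs d v =>
      simp only [map_smul, inner_smul_left, inner_smul_right]
      congr 2
      obtain ⟨m, u⟩ := u
      obtain ⟨n, v⟩ := v
      simp only [create, annihilate, PreFock.lift_e]
      rw [PreFock.inner_e]
      cases n with
      | zero => simp [annihilateWord, gram_ne]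
      | succ n =>
        simp only [annihilateWord, inner_sum]
        by_cases hmn : m = n
        · subst hmn
          rw [gram_cons]
          push_cast
          refine Finset.sum_congr rfl fun k _ => ?_
          by_cases h : v k = i
          · simp [h, inner_smul_right, PreFock.inner_e]
          · simp [h]
        · rw [gram_ne _ _ _ (by simpa using hmn)]
          symm
          rw [Complex.ofReal_zero]
          refine Finset.sum_eq_zero fun k _ => ?_
          split_ifs
          · rw [inner_smul_right, PreFock.inner_e, gram_ne _ _ _ (by simpa using hmn)]
            simp
          · simp

theorem annihilate_create (Q : QMatrix N) (i : Fin N) (x : PreFock Q) :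
    annihilate Q i (create Q i x) = x + (Q.coef i i : ℂ) • create Q i (annihilate Q i x) := by
  induction x using PreFock.induction with
  | h0 => simp
  | hadd x x' hx hx' => simp only [map_add, hx, hx', smul_add]; abel
  | hs c u =>
    simp only [map_smul]
    rw [smul_comm _ c, ← smul_add]
    congr 1
    obtain ⟨n, v⟩ := u
    simp only [create, annihilate, PreFock.lift_e, annihilateWord]
    rw [Fin.sum_univ_succ]
    congr 1
    · have : (Fin.cons i v : Fin (n + 1) → Fin N) ∘ Fin.succAbove 0 = v := by
        ext k; simp
      simp only [Fin.cons_zero, if_true, this]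
      simp
    · cases n with
      | zero => simp
      | succ n =>
        simp only [map_sum, Finset.smul_sum]
        refine Finset.sum_congr rfl fun k _ => ?_
        simp only [Fin.cons_succ]
        by_cases h : v k = i
        · simp only [h, if_true, map_smul, PreFock.lift_e]
          rw [smul_smul]
          congr 1
          · rw [Fin.prod_univ_succ]
            simp
          · congr 1
            congr 1
            ext l
            refine Fin.cases ?_ (fun l => ?_) l
            · simp
            · simp
        · simp [h]

theorem norm_create_le_aux (Q : QMatrix N) (i : Fin N) (n : ℕ) (x : PreFock Q)
    (hx : x ∈ (Submodule.span ℂ (PreFock.e Q '' {u | u.1 < n}))) :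
    ‖create Q i x‖ ^ 2 ≤ (1 - |Q.coef i i|)⁻¹ * ‖x‖ ^ 2 := by
  set C : ℝ := (1 - |Q.coef i i|)⁻¹ with hC
  have hq : 0 < 1 - |Q.coef i i| := by linarith [Q.abs_lt_one i i]
  have hC0 : 0 < C := inv_pos.2 hq
  have hCq : 1 + |Q.coef i i| * C = C := by
    rw [hC]; field_simp; ring
  induction n generalizing x with
  | zero =>
    have : x = 0 := by simpa using hx
    simp [this]
  | succ n ih =>
    have ha : annihilate Q i x ∈ Submodule.span ℂ (PreFock.e Q '' {u | u.1 < n}) := by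
      have hle : Submodule.span ℂ (PreFock.e Q '' {u | u.1 < n + 1}) ≤
          (Submodule.span ℂ (PreFock.e Q '' {u | u.1 < n})).comap (annihilate Q i) := by
        rw [Submodule.span_le]
        rintro _ ⟨⟨m, v⟩, hm, rfl⟩
        simp only [Set.mem_ofPred_eq] at hm
        simp only [Submodule.comap_coe, Set.mem_preimage, SetLike.mem_coe, annihilate,
          PreFock.lift_e]
        cases m with
        | zero => simp [annihilateWord]
        | succ m =>
          simp only [annihilateWord]
          refine Submodule.sum_mem _ fun k _ => ?_
          split_ifs
          · refine Submodule.smul_mem _ _ (Submodule.subset_span ⟨_, ?_, rfl⟩)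
            simp only [Set.mem_ofPred_eq]
            omega
          · exact Submodule.zero_mem _
      exact hle hx
    have h1 : ‖create Q i x‖ ^ 2 = ‖x‖ ^ 2 + Q.coef i i * ‖annihilate Q i x‖ ^ 2 := by
      have : ((‖create Q i x‖ ^ 2 : ℝ) : ℂ) =
          ((‖x‖ ^ 2 + Q.coef i i * ‖annihilate Q i x‖ ^ 2 : ℝ) : ℂ) := by
        push_cast
        have e1 := inner_self_eq_norm_sq_to_K (𝕜 := ℂ) (create Q i x)
        have e2 := inner_self_eq_norm_sq_to_K (𝕜 := ℂ) x
        have e3 := inner_self_eq_norm_sq_to_K (𝕜 := ℂ) (annihilate Q i x)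
        simp only [Complex.coe_algebraMap] at e1 e2 e3
        rw [← e1, ← e2, ← e3, inner_create_left, annihilate_create, inner_add_right,
          inner_smul_right, ← inner_conj_symm x (create Q i _), inner_create_left, inner_conj_symm]
      exact_mod_cast this
    have h2 : ‖annihilate Q i x‖ ^ 2 ≤ C * ‖x‖ ^ 2 := by
      set y := annihilate Q i x with hy
      have e3 : ‖y‖ ^ 2 ≤ ‖create Q i y‖ * ‖x‖ := by
        rw [← inner_self_eq_norm_sq (𝕜 := ℂ) y]
        nth_rewrite 2 [hy]
        rw [← inner_create_left]
        exact re_inner_le_norm _ _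
      have e4 := ih y ha
      have e5 : ‖y‖ ^ 2 * ‖y‖ ^ 2 ≤ (C * ‖x‖ ^ 2) * ‖y‖ ^ 2 := by
        calc ‖y‖ ^ 2 * ‖y‖ ^ 2 ≤ (‖create Q i y‖ * ‖x‖) * (‖create Q i y‖ * ‖x‖) :=
              mul_le_mul e3 e3 (by positivity) (by positivity)
          _ = ‖create Q i y‖ ^ 2 * ‖x‖ ^ 2 := by ring
          _ ≤ (C * ‖y‖ ^ 2) * ‖x‖ ^ 2 := by gcongr
          _ = _ := by ring
      rcases (sq_nonneg ‖y‖).eq_or_lt with h | h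
      · rw [← h]; positivity
      · exact le_of_mul_le_mul_right e5 h
    calc ‖create Q i x‖ ^ 2 = ‖x‖ ^ 2 + Q.coef i i * ‖annihilate Q i x‖ ^ 2 := h1
      _ ≤ ‖x‖ ^ 2 + |Q.coef i i| * (C * ‖x‖ ^ 2) := by
        have := le_abs_self (Q.coef i i)
        gcongr
      _ = (1 + |Q.coef i i| * C) * ‖x‖ ^ 2 := by ring
      _ = C * ‖x‖ ^ 2 := by rw [hCq]

theorem norm_create_le (Q : QMatrix N) (i : Fin N) (x : PreFock Q) :
    ‖create Q i x‖ ≤ √((1 - |Q.coef i i|)⁻¹) * ‖x‖ := by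
  have hx : ∃ n, x ∈ Submodule.span ℂ (PreFock.e Q '' {u | u.1 < n}) := by
    induction x using PreFock.induction with
    | h0 => exact ⟨0, Submodule.zero_mem _⟩
    | hadd x y hx hy =>
      obtain ⟨n, hn⟩ := hx
      obtain ⟨m, hm⟩ := hy
      refine ⟨max n m, Submodule.add_mem _ ?_ ?_⟩
      · refine Submodule.span_mono (Set.image_mono fun u hu => ?_) hn
        exact lt_of_lt_of_le (show u.1 < _ from hu) (le_max_left _ _)
      · refine Submodule.span_mono (Set.image_mono fun u hu => ?_) hm
        exact lt_of_lt_of_le (show u.1 < _ from hu) (le_max_right _ _)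
    | hs c u =>
      exact ⟨u.1 + 1, Submodule.smul_mem _ _ (Submodule.subset_span ⟨u, Nat.lt_succ_self _, rfl⟩)⟩
  obtain ⟨n, hn⟩ := hx
  have hq : 0 < 1 - |Q.coef i i| := by linarith [Q.abs_lt_one i i]
  refine le_of_sq_le_sq ?_ (by positivity)
  rw [mul_pow, Real.sq_sqrt (by positivity)]
  exact norm_create_le_aux Q i n x hn

/-- The Fock space `F_Q`: the Hilbert space obtained by completing the algebraic Fock space with
respect to the `Q`-inner product. -/
abbrev Fock (Q : QMatrix N) : Type := UniformSpace.Completion (PreFock Q)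

/-- The vacuum vector `Ω`. -/
noncomputable def vacuum (Q : QMatrix N) : Fock Q :=
  ((PreFock.e Q ⟨0, Fin.elim0⟩ : PreFock Q) : Fock Q)

/-- The left creation operator `l_i` on the Fock space. -/
noncomputable def creation (Q : QMatrix N) (i : Fin N) : Fock Q →L[ℂ] Fock Q :=
  ((create Q i).mkContinuous _ (norm_create_le Q i)).completion

theorem creation_coe (Q : QMatrix N) (i : Fin N) (x : PreFock Q) :
    creation Q i (x : Fock Q) = (create Q i x : PreFock Q) := by
  simp [creation]

/-- The adjoint of `l_i` is given by the usual annihilation formula. -/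
theorem adjoint_creation_coe (Q : QMatrix N) (i : Fin N) (x : PreFock Q) :
    ContinuousLinearMap.adjoint (creation Q i) (x : Fock Q) = (annihilate Q i x : PreFock Q) := by
  refine UniformSpace.Completion.denseRange_coe.eq_of_inner_right ℂ fun y => ?_
  rw [ContinuousLinearMap.adjoint_inner_right, creation_coe, UniformSpace.Completion.inner_coe,
    UniformSpace.Completion.inner_coe, inner_create_left]

/-- The mixed `q`-Gaussian variable `X_i = l_i + l_i^*`. -/
noncomputable def gaussian (Q : QMatrix N) (i : Fin N) : Fock Q →L[ℂ] Fock Q :=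
  creation Q i + ContinuousLinearMap.adjoint (creation Q i)

/-- The mixed `q`-Gaussian von Neumann algebra `Γ_Q`, generated by `X_1, ..., X_N`: their double
commutant in the bounded operators on the Fock space. -/
noncomputable def gaussianAlgebra (Q : QMatrix N) : VonNeumannAlgebra (Fock Q) where
  toStarSubalgebra := StarSubalgebra.centralizer ℂ
    (StarSubalgebra.centralizer ℂ (Set.range (gaussian Q)) : Set (Fock Q →L[ℂ] Fock Q))
  centralizer_centralizer' := by
    change Set.centralizer (Set.centralizer ((StarSubalgebra.centralizer ℂ
      (StarSubalgebra.centralizer ℂ (Set.range (gaussian Q)) : Set (Fock Q →L[ℂ] Fock Q)) :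
        StarSubalgebra ℂ (Fock Q →L[ℂ] Fock Q)) : Set (Fock Q →L[ℂ] Fock Q))) = _
    rw [StarSubalgebra.coe_centralizer_centralizer, Set.centralizer_centralizer_centralizer]
    exact (StarSubalgebra.coe_centralizer_centralizer ℂ _).symm

/-- The vacuum state `τ_Q(T) = ⟨T Ω, Ω⟩_Q` (linear in `T`). -/
noncomputable def trace (Q : QMatrix N) : (Fock Q →L[ℂ] Fock Q) →ₗ[ℂ] ℂ where
  toFun T := inner ℂ (vacuum Q) (T (vacuum Q))
  map_add' S T := by simp [inner_add_right]
  map_smul' c T := by simp [inner_smul_right]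

/-- The noncommutative polynomials in `Y_1, ..., Y_N`, as a complex vector space with the monomials
`Y_w = Y_{w_1} ⋯ Y_{w_n}`, indexed by words `w`, as basis. -/
abbrev NCPoly (N : ℕ) : Type := List (Fin N) →₀ ℂ

/-- The value `P(X_1, ..., X_N)` of a noncommutative polynomial at the mixed `q`-Gaussian
variables. -/
noncomputable def polyEval (Q : QMatrix N) : NCPoly N →ₗ[ℂ] (Fock Q →L[ℂ] Fock Q) :=
  Finsupp.linearCombination ℂ fun w => (w.map (gaussian Q)).prod

/-- The `j`-th free difference quotient `∂_j : P ↦ ∑_{P = A Y_j B} A ⊗ B` (on monomials `P`). -/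
noncomputable def freeDiff (j : Fin N) : NCPoly N →ₗ[ℂ] NCPoly N ⊗[ℂ] NCPoly N :=
  Finsupp.linearCombination ℂ fun w => ∑ k : Fin w.length,
    if w.get k = j then
      (Finsupp.single (w.take k) 1 : NCPoly N) ⊗ₜ[ℂ] (Finsupp.single (w.drop (k + 1)) 1 : NCPoly N)
    else 0

/-- The functional `A ⊗ B ↦ τ_Q(A(X)) τ_Q(B(X))`, that is `τ_Q ⊗ τ_Q^op` after evaluation at the
mixed `q`-Gaussian variables. -/
noncomputable def tensorTrace (Q : QMatrix N) : NCPoly N ⊗[ℂ] NCPoly N →ₗ[ℂ] ℂ :=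
  LinearMap.mul' ℂ ℂ ∘ₗ
    TensorProduct.map (trace Q ∘ₗ polyEval Q) (trace Q ∘ₗ polyEval Q)

/-- The operators `η_1, ..., η_N` are the conjugate variables of `X_1, ..., X_N`: they belong to
`Γ_Q` (identified with a subspace of `L²(Γ_Q, τ_Q) ≅ F_Q` through `T ↦ T Ω`), and
`⟨η_j, P(X)⟩_{τ_Q} = ⟨1 ⊗ 1, ∂_j P⟩_{τ_Q ⊗ τ_Q^op}` for every noncommutative polynomial `P`. -/
def IsConjugateSystem (Q : QMatrix N) (η : Fin N → (Fock Q →L[ℂ] Fock Q)) : Prop :=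
  ∀ j, η j ∈ gaussianAlgebra Q ∧ ∀ P : NCPoly N,
    inner ℂ (η j (vacuum Q)) (polyEval Q P (vacuum Q)) = tensorTrace Q (freeDiff j P)

/-- Noncommutative power series `F = ∑_w F_w Y_w`, given by their coefficients. -/
abbrev NCSeries (N : ℕ) : Type := List (Fin N) → ℂ

/-- `‖F‖_R = ∑_w |F_w| R^{|w|}`, with value `∞` if the sum diverges (for `R ≥ 0`). -/
noncomputable def NCSeries.rNorm (R : ℝ) (F : NCSeries N) : ℝ≥0∞ :=
  ∑' w : List (Fin N), ‖F w‖ₑ * ENNReal.ofReal R ^ w.length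

/-- The radius of convergence of the series is greater than `R`. -/
def NCSeries.RadiusGT (R : ℝ) (F : NCSeries N) : Prop :=
  ∃ R' > R, F.rNorm R' < ∞

/-- The power series `Y_i`. -/
noncomputable def NCSeries.var (i : Fin N) : NCSeries N := Pi.single [i] 1

/-- Invariance under the involution determined by `Y_i^* = Y_i`, which sends `c Y_{i_1} ⋯ Y_{i_n}`
to `conj c Y_{i_n} ⋯ Y_{i_1}`. -/
def NCSeries.SelfAdjoint (F : NCSeries N) : Prop :=
  ∀ w : List (Fin N), conj (F w.reverse) = F w

/-- The cyclic gradient `D_i : P ↦ ∑_{P = A Y_i B} B A` (on monomials `P`), extended to power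
series: the coefficient of `Y_u` in `D_i F` is the sum of the coefficients of `A Y_i B` in `F` over
the `|u| + 1` factorizations `u = B A`. -/
def NCSeries.cyclicGradient (i : Fin N) (F : NCSeries N) : NCSeries N :=
  fun u => ∑ k ∈ Finset.range (u.length + 1), F (u.drop k ++ i :: u.take k)

/-- The value `F(X_1, ..., X_N) = ∑_w F_w X_w` (a norm-convergent sum as soon as the radius of
convergence of `F` exceeds every `‖X_i‖`). -/
noncomputable def NCSeries.eval (Q : QMatrix N) (F : NCSeries N) : Fock Q →L[ℂ] Fock Q :=
  ∑' w : List (Fin N), F w • (w.map (gaussian Q)).prod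

/-- `q = max_{i,j} |q_{ij}|`. -/
noncomputable def QMatrix.maxAbs (Q : QMatrix N) : ℝ := ⨆ p : Fin N × Fin N, |Q.coef p.1 p.2|

/-- The radius `R = (2 + ε) / (1 - q)`. -/
noncomputable def radius (ε q : ℝ) : ℝ := (2 + ε) / (1 - q)

/-- `π(q, N) = q N² (3 + ε)² / (1 - q (3 - 2 q + (3 + ε)² N²))`. -/
noncomputable def piBound (ε q : ℝ) (N : ℕ) : ℝ :=
  q * N ^ 2 * (3 + ε) ^ 2 / (1 - q * (3 - 2 * q + (3 + ε) ^ 2 * N ^ 2))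

/-- The standing smallness assumption: the denominator of `π(q, N)` is positive, so that `π(q, N)`
is defined, and `π(q, N) < 1`. -/
def QMatrix.IsSmall (ε : ℝ) (Q : QMatrix N) : Prop :=
  Q.maxAbs * (3 - 2 * Q.maxAbs + (3 + ε) ^ 2 * N ^ 2) < 1 ∧ piBound ε Q.maxAbs N < 1

end MixedQ

/-! Identify words with basis tensors. The vector of the j-th conjugate variable is D_j^*Ω, where
D_j is an operator on the algebraic Fock space with [D_j, X_i] = δ_ij P_Ω and D_j Ω = 0. Moving D_j
through X_{u_1}⋯X_{u_n}Ω leaves a term τ(B(X)) A(X)Ω for each factorization u = A j B, so its vacuum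
coefficient is (τ⊗τ)(∂_j u) (`dualOp_field`, `conjFunctional_toVector`). The operator is explicit:
on e_v it sums over v = a j b and contracts b into e_a by right annihilators, with a factor -q_{jk}
and further weights for each letter k of b. If q/(1-q) ≤ σ², the vacuum coefficient of D_j e_v is at
most |v| σ^{|v|-1} (`norm_conjFunctional_le`).

To turn this functional into a power series, expand it in the basis dual to the words and apply the
Wick map, the inverse of P ↦ P(X)Ω. The dual basis is built with the inverse of G = P_Ω + ∑ l_i
l_i^*. In every weighted ℓ¹-norm G differs from 1 by at most q/(1-q), so each letter costs a factor
(1-q)/(1-2q) (`form_dualVec`, `wnorm_dualVec_le`). The Wick map is bounded from radius (3+ε)/(1-q)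
to a radius R' > R (`wnorm_wick_le`). The words of length n thus contribute at most σ⁻¹ n
(Nσ(3+ε)/(1-2q))^n, and π(q,N) < 1 leaves room for a σ making this summable (`exists_rate`). The
words of length at most 1 contribute exactly Y_j and the others O(σ), which gives the limit q → 0.

A power series of large enough radius is determined by its pairings with polynomials in the X_i
(`eq_zero_of_forall_pairing`), so identities between series can be checked on moments. Traciality
gives ξ_j^* = ξ_j, and a telescoping identity for ∂_i shows that ∑ Y_i ξ_i is self-adjoint, that is
∑ [Y_i, ξ_i] = 0. The coefficients of ∑ Y_i ξ_i are then invariant under cyclic rotation, and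
dividing each by its degree gives V. -/

namespace MixedQ

open scoped ComplexConjugate ENNReal TensorProduct

variable {N : ℕ}

/-! ### Creation and annihilation operators on words, and their commutation relations. -/

/-- The entry `q_{ij}` as a complex number. -/
noncomputable def QMatrix.entry (Q : QMatrix N) (i j : Fin N) : ℂ := (Q.coef i j : ℂ)

theorem QMatrix.entry_comm (Q : QMatrix N) (i j : Fin N) : Q.entry i j = Q.entry j i := by
  simp [QMatrix.entry, Q.coef_comm i j]

/-- The product `∏_k q_{i v_k}` over the letters of a word. -/
noncomputable def QMatrix.wordWeight (Q : QMatrix N) (i : Fin N) (v : List (Fin N)) : ℂ :=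
  (v.map (Q.entry i)).prod

@[simp] theorem QMatrix.wordWeight_nil (Q : QMatrix N) (i : Fin N) : Q.wordWeight i [] = 1 := rfl

@[simp] theorem QMatrix.wordWeight_cons (Q : QMatrix N) (i k : Fin N) (v : List (Fin N)) :
    Q.wordWeight i (k :: v) = Q.entry i k * Q.wordWeight i v := by
  simp [QMatrix.wordWeight]

theorem QMatrix.wordWeight_append_singleton (Q : QMatrix N) (i k : Fin N) (v : List (Fin N)) :
    Q.wordWeight i (v ++ [k]) = Q.entry i k * Q.wordWeight i v := by
  simp [QMatrix.wordWeight, mul_comm]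

/-- The basis element attached to a word. -/
noncomputable abbrev word (u : List (Fin N)) : NCPoly N := Finsupp.single u 1

theorem hom_ext_word {M : Type*} [AddCommGroup M] [Module ℂ M] {S T : NCPoly N →ₗ[ℂ] M}
    (h : ∀ u, S (word u) = T (word u)) : S = T :=
  Finsupp.lhom_ext' fun u => LinearMap.ext_ring (h u)

/-- Prefixing a letter: left creation, and left multiplication of polynomials by a variable. -/
noncomputable def lcr (i : Fin N) : NCPoly N →ₗ[ℂ] NCPoly N :=
  Finsupp.linearCombination ℂ fun v => word (i :: v)

/-- Appending a letter: right creation. -/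
noncomputable def rcr (i : Fin N) : NCPoly N →ₗ[ℂ] NCPoly N :=
  Finsupp.linearCombination ℂ fun v => word (v ++ [i])

@[simp] theorem lcr_word (i : Fin N) (v : List (Fin N)) : lcr i (word v) = word (i :: v) := by
  simp [lcr]

@[simp] theorem rcr_word (i : Fin N) (v : List (Fin N)) : rcr i (word v) = word (v ++ [i]) := by
  simp [rcr]

/-- Left annihilation of a word. -/
noncomputable def lannWord (Q : QMatrix N) (i : Fin N) : List (Fin N) → NCPoly N
  | [] => 0
  | k :: v => (if k = i then word v else 0) + Q.entry i k • lcr k (lannWord Q i v)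

/-- Right annihilation of a word. -/
noncomputable def rannWord (Q : QMatrix N) (k : Fin N) : List (Fin N) → NCPoly N
  | [] => 0
  | i :: v => lcr i (rannWord Q k v) + if i = k then Q.wordWeight k v • word v else 0

/-- Left annihilation. -/
noncomputable def lann (Q : QMatrix N) (i : Fin N) : NCPoly N →ₗ[ℂ] NCPoly N :=
  Finsupp.linearCombination ℂ (lannWord Q i)

/-- Right annihilation. -/
noncomputable def rann (Q : QMatrix N) (i : Fin N) : NCPoly N →ₗ[ℂ] NCPoly N :=
  Finsupp.linearCombination ℂ (rannWord Q i)

/-- The diagonal operator `e_v ↦ ∏_k q_{i v_k} e_v`. -/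
noncomputable def diagWeight (Q : QMatrix N) (i : Fin N) : NCPoly N →ₗ[ℂ] NCPoly N :=
  Finsupp.linearCombination ℂ fun v => Q.wordWeight i v • word v

theorem diagWeight_word (Q : QMatrix N) (i : Fin N) (v : List (Fin N)) :
    diagWeight Q i (word v) = Q.wordWeight i v • word v := by
  simp [diagWeight]

@[simp] theorem lann_nil (Q : QMatrix N) (i : Fin N) : lann Q i (word []) = 0 := by
  simp [lann, lannWord]

@[simp] theorem rann_nil (Q : QMatrix N) (i : Fin N) : rann Q i (word []) = 0 := by
  simp [rann, rannWord]

theorem lann_cons (Q : QMatrix N) (i k : Fin N) (v : List (Fin N)) :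
    lann Q i (word (k :: v)) =
      (if k = i then word v else 0) + Q.entry i k • lcr k (lann Q i (word v)) := by
  simp [lann, lannWord]

/-- This relation and `lann_nil` determine left annihilation; `annihilate_create_eq` is its
counterpart in the Fock space and later identifies the two. -/
theorem lann_lcr (Q : QMatrix N) (i k : Fin N) (x : NCPoly N) :
    lann Q i (lcr k x) = (if k = i then x else 0) + Q.entry i k • lcr k (lann Q i x) := by
  have : lann Q i ∘ₗ lcr k =
      (if k = i then LinearMap.id else 0) + Q.entry i k • (lcr k ∘ₗ lann Q i) := by
    refine hom_ext_word fun u => ?_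
    split_ifs with h <;> simp [lann_cons, h]
  have := congrArg (fun T => T x) this
  split_ifs at this ⊢ <;> simpa using this

theorem rann_lcr (Q : QMatrix N) (k i : Fin N) (x : NCPoly N) :
    rann Q k (lcr i x) = lcr i (rann Q k x) + if i = k then diagWeight Q k x else 0 := by
  have : rann Q k ∘ₗ lcr i = lcr i ∘ₗ rann Q k + if i = k then diagWeight Q k else 0 := by
    refine hom_ext_word fun u => ?_
    split_ifs with h <;> simp [rann, rannWord, diagWeight_word, h]
  have := congrArg (fun T => T x) this
  split_ifs at this ⊢ <;> simpa using this

theorem rcr_lcr (k i : Fin N) (x : NCPoly N) : rcr k (lcr i x) = lcr i (rcr k x) := by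
  have : rcr k ∘ₗ lcr i = lcr i ∘ₗ rcr k := hom_ext_word fun u => by simp
  exact congrArg (fun T => T x) this

theorem diagWeight_lcr (Q : QMatrix N) (k i : Fin N) (x : NCPoly N) :
    diagWeight Q k (lcr i x) = Q.entry k i • lcr i (diagWeight Q k x) := by
  have : diagWeight Q k ∘ₗ lcr i = Q.entry k i • (lcr i ∘ₗ diagWeight Q k) :=
    hom_ext_word fun u => by
      simp only [LinearMap.comp_apply, LinearMap.smul_apply, lcr_word, diagWeight_word, map_smul,
        QMatrix.wordWeight_cons, mul_smul]
  exact congrArg (fun T => T x) this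

theorem diagWeight_rcr (Q : QMatrix N) (k i : Fin N) (x : NCPoly N) :
    diagWeight Q k (rcr i x) = Q.entry k i • rcr i (diagWeight Q k x) := by
  have : diagWeight Q k ∘ₗ rcr i = Q.entry k i • (rcr i ∘ₗ diagWeight Q k) :=
    hom_ext_word fun u => by
      simp only [LinearMap.comp_apply, LinearMap.smul_apply, rcr_word, diagWeight_word, map_smul,
        QMatrix.wordWeight_append_singleton, mul_smul]
  exact congrArg (fun T => T x) this

theorem diagWeight_comm (Q : QMatrix N) (k i : Fin N) (x : NCPoly N) :
    diagWeight Q k (diagWeight Q i x) = diagWeight Q i (diagWeight Q k x) := by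
  have : diagWeight Q k ∘ₗ diagWeight Q i = diagWeight Q i ∘ₗ diagWeight Q k :=
    hom_ext_word fun u => by
      simp only [LinearMap.comp_apply, diagWeight_word, map_smul, smul_smul, mul_comm]
  exact congrArg (fun T => T x) this

/-- Induction over words for identities between linear maps. -/
theorem eq_of_word_induction {M : Type*} [AddCommGroup M] [Module ℂ M] {S T : NCPoly N →ₗ[ℂ] M}
    (h0 : S (word []) = T (word []))
    (hc : ∀ i u, S (word u) = T (word u) → S (lcr i (word u)) = T (lcr i (word u)))
    (x : NCPoly N) : S x = T x := by
  have : S = T := by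
    refine hom_ext_word fun u => ?_
    induction u with
    | nil => exact h0
    | cons i u ih => simpa using hc i u ih
  rw [this]

theorem lann_diagWeight (Q : QMatrix N) (i k : Fin N) (x : NCPoly N) :
    lann Q i (diagWeight Q k x) = Q.entry k i • diagWeight Q k (lann Q i x) := by
  refine eq_of_word_induction (S := lann Q i ∘ₗ diagWeight Q k)
    (T := Q.entry k i • (diagWeight Q k ∘ₗ lann Q i)) (by simp [diagWeight_word]) ?_ x
  intro m u ih
  simp only [LinearMap.comp_apply, LinearMap.smul_apply] at ih ⊢
  rw [diagWeight_lcr, map_smul, lann_lcr, lann_lcr, ih]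
  simp only [map_add, map_smul, diagWeight_lcr, smul_add, smul_smul]
  congr 1
  · split_ifs with h
    · rw [h]
    · simp
  · congr 1; ring

theorem rann_diagWeight (Q : QMatrix N) (i k : Fin N) (x : NCPoly N) :
    rann Q i (diagWeight Q k x) = Q.entry k i • diagWeight Q k (rann Q i x) := by
  refine eq_of_word_induction (S := rann Q i ∘ₗ diagWeight Q k)
    (T := Q.entry k i • (diagWeight Q k ∘ₗ rann Q i)) (by simp [diagWeight_word]) ?_ x
  intro m u ih
  simp only [LinearMap.comp_apply, LinearMap.smul_apply] at ih ⊢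
  rw [diagWeight_lcr, map_smul, rann_lcr, rann_lcr, ih]
  simp only [map_add, map_smul, diagWeight_lcr, smul_add, smul_smul]
  congr 1
  · congr 1; ring
  · split_ifs with h
    · rw [h, diagWeight_comm]
    · simp

/-- When the right annihilator removes the first letter `m = k`, the diagonal weight it leaves
supplies the factor q_{im} that the left annihilator would have picked up in passing `m`. -/
theorem lann_rann (Q : QMatrix N) (i k : Fin N) (x : NCPoly N) :
    lann Q i (rann Q k x) = rann Q k (lann Q i x) := by
  refine eq_of_word_induction (S := lann Q i ∘ₗ rann Q k)
    (T := rann Q k ∘ₗ lann Q i) (by simp) ?_ x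
  intro m u ih
  simp only [LinearMap.comp_apply] at ih ⊢
  rw [rann_lcr, map_add, lann_lcr, lann_lcr, ih, map_add, map_smul, rann_lcr]
  have e1 : lann Q i (if m = k then diagWeight Q k (word u) else 0) =
      Q.entry i m • if m = k then diagWeight Q k (lann Q i (word u)) else 0 := by
    split_ifs with h
    · rw [lann_diagWeight, h, Q.entry_comm k]
    · rw [map_zero, smul_zero]
  have e2 : rann Q k (if m = i then word u else 0) = if m = i then rann Q k (word u) else 0 := by
    split_ifs
    · rfl
    · rw [map_zero]
  rw [e1, e2, smul_add, add_assoc]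

/-- Reaching an appended letter from the left means passing the whole word, which costs exactly the
diagonal weight. -/
theorem lann_rcr (Q : QMatrix N) (i k : Fin N) (x : NCPoly N) :
    lann Q i (rcr k x) = rcr k (lann Q i x) + if i = k then diagWeight Q i x else 0 := by
  have := eq_of_word_induction (S := lann Q i ∘ₗ rcr k)
    (T := rcr k ∘ₗ lann Q i + if i = k then diagWeight Q i else 0) ?_ ?_ x
  · split_ifs at this ⊢ <;> simpa using this
  · have : rcr k (word []) = lcr k (word []) := by simp
    simp only [LinearMap.comp_apply, this, lann_lcr]
    by_cases h : i = k
    · simp [h, diagWeight_word]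
    · simp [h, Ne.symm h]
  · intro m u ih
    by_cases h : i = k
    · simp only [h, LinearMap.comp_apply, LinearMap.add_apply, if_true] at ih ⊢
      rw [rcr_lcr, lann_lcr, ih, lann_lcr, diagWeight_lcr]
      simp only [map_add, map_smul, rcr_lcr, smul_add]
      split_ifs <;> simp [add_assoc]
    · simp only [h, LinearMap.comp_apply, if_false, add_zero] at ih ⊢
      rw [rcr_lcr, lann_lcr, ih, lann_lcr]
      simp only [map_add, map_smul, rcr_lcr]
      split_ifs <;> simp

/-! ### Field operators, moments and traciality. -/

/-- The field operator `l_i + l_i^*`. -/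
noncomputable def field (Q : QMatrix N) (i : Fin N) : NCPoly N →ₗ[ℂ] NCPoly N := lcr i + lann Q i

theorem field_apply (Q : QMatrix N) (i : Fin N) (x : NCPoly N) :
    field Q i x = lcr i x + lann Q i x := rfl

theorem field_rcr (Q : QMatrix N) (i k : Fin N) (x : NCPoly N) :
    field Q i (rcr k x) = rcr k (field Q i x) + if i = k then diagWeight Q i x else 0 := by
  rw [field_apply, field_apply, lann_rcr, map_add, rcr_lcr, add_assoc]

theorem rann_field (Q : QMatrix N) (k i : Fin N) (x : NCPoly N) :
    rann Q k (field Q i x) = field Q i (rann Q k x) + if i = k then diagWeight Q k x else 0 := by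
  rw [field_apply, field_apply, map_add, rann_lcr, lann_rann]
  abel

/-- The vector `X_{w_1} ⋯ X_{w_n} Ω`. -/
noncomputable def fieldWord (Q : QMatrix N) : List (Fin N) → NCPoly N
  | [] => word []
  | i :: w => field Q i (fieldWord Q w)

/-- The linear map `P ↦ P(X) Ω`. -/
noncomputable def toVector (Q : QMatrix N) : NCPoly N →ₗ[ℂ] NCPoly N :=
  Finsupp.linearCombination ℂ (fieldWord Q)

@[simp] theorem toVector_nil (Q : QMatrix N) : toVector Q (word []) = word [] := by
  simp [toVector, fieldWord]

theorem toVector_lcr (Q : QMatrix N) (i : Fin N) (x : NCPoly N) :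
    toVector Q (lcr i x) = field Q i (toVector Q x) := by
  have : toVector Q ∘ₗ lcr i = field Q i ∘ₗ toVector Q :=
    hom_ext_word fun u => by simp [toVector, fieldWord]
  exact congrArg (fun T => T x) this

theorem toVector_cons (Q : QMatrix N) (i : Fin N) (w : List (Fin N)) :
    toVector Q (word (i :: w)) = field Q i (toVector Q (word w)) := by
  rw [← lcr_word, toVector_lcr]

/-- The moment `τ_Q(X_{w_1} ⋯ X_{w_n})`. -/
noncomputable def moment (Q : QMatrix N) (w : List (Fin N)) : ℂ := toVector Q (word w) []

@[simp] theorem moment_nil (Q : QMatrix N) : moment Q [] = 1 := by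
  simp [moment]

@[simp] theorem lcr_apply_nil (i : Fin N) (x : NCPoly N) : lcr i x [] = 0 := by
  have := eq_of_word_induction (S := Finsupp.lapply [] ∘ₗ lcr i) (T := 0) (by simp) (by simp) x
  simpa using this

theorem lcr_apply_cons (i k : Fin N) (x : NCPoly N) (u : List (Fin N)) :
    lcr i x (k :: u) = if i = k then x u else 0 := by
  have : Finsupp.lapply (k :: u) ∘ₗ lcr i =
      (if i = k then Finsupp.lapply u else 0 : NCPoly N →ₗ[ℂ] ℂ) := by
    refine hom_ext_word fun v => ?_
    by_cases h : i = k
    · by_cases h' : v = u <;> simp [h, h']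
    · simp [h]
  have := congrArg (fun T => T x) this
  split_ifs at this ⊢ <;> simpa using this

theorem lann_apply_nil (Q : QMatrix N) (i : Fin N) (x : NCPoly N) : lann Q i x [] = x [i] := by
  have := eq_of_word_induction (S := Finsupp.lapply [] ∘ₗ lann Q i) (T := Finsupp.lapply [i])
    (by simp) ?_ x
  · simpa using this
  · intro k u _
    rcases u with _ | ⟨l, u⟩ <;> by_cases h : k = i <;>
    simp [lann_cons, h]

theorem rann_apply_nil (Q : QMatrix N) (i : Fin N) (x : NCPoly N) : rann Q i x [] = x [i] := by
  have := eq_of_word_induction (S := Finsupp.lapply [] ∘ₗ rann Q i) (T := Finsupp.lapply [i])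
    (by simp) ?_ x
  · simpa using this
  · intro k u _
    simp only [LinearMap.comp_apply, rann_lcr, Finsupp.lapply_apply, Finsupp.add_apply,
      lcr_apply_nil, lcr_apply_cons, zero_add]
    split_ifs
    · rcases u with _ | ⟨l, u⟩ <;> simp [diagWeight_word]
    · simp

@[simp] theorem rcr_apply_nil (i : Fin N) (x : NCPoly N) : rcr i x [] = 0 := by
  have := eq_of_word_induction (S := Finsupp.lapply [] ∘ₗ rcr i) (T := 0) (by simp) (by simp) x
  simpa using this

/-- The defects in `field_rcr` and `rann_field` cancel, so the right field operator `rcr i + rann Q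
i` commutes with every `field Q k` and agrees with `field Q i` on the vacuum. -/
theorem toVector_append_singleton (Q : QMatrix N) (i : Fin N) (w : List (Fin N)) :
    toVector Q (word (w ++ [i])) =
      rcr i (toVector Q (word w)) + rann Q i (toVector Q (word w)) := by
  induction w with
  | nil => simp [toVector_cons, field_apply]
  | cons k w ih =>
    rw [List.cons_append, toVector_cons, ih, toVector_cons, map_add, field_rcr, rann_field]
    by_cases h : k = i
    · subst h; simp; abel
    · simp [h]

theorem moment_cons (Q : QMatrix N) (i : Fin N) (w : List (Fin N)) :
    moment Q (i :: w) = toVector Q (word w) [i] := by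
  rw [moment, toVector_cons, field_apply, Finsupp.add_apply, lcr_apply_nil, lann_apply_nil,
    zero_add]

theorem moment_append_singleton (Q : QMatrix N) (i : Fin N) (w : List (Fin N)) :
    moment Q (w ++ [i]) = moment Q (i :: w) := by
  rw [moment_cons, moment, toVector_append_singleton, Finsupp.add_apply, rcr_apply_nil,
    rann_apply_nil, zero_add]

/-- The vacuum state is tracial. -/
theorem moment_append_comm (Q : QMatrix N) (u w : List (Fin N)) :
    moment Q (u ++ w) = moment Q (w ++ u) := by
  induction u generalizing w with
  | nil => simp
  | cons i u ih =>
    rw [List.cons_append, ← moment_append_singleton, List.append_assoc, ih, List.append_assoc]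
    rfl

/-! ### The dual operator D_j. -/

/-- The weighted contraction `± ∏ q ⋅ r_{b_1}^* ⋯ r_{b_m}^*` of a word `b` into a vector. -/
noncomputable def contract (Q : QMatrix N) (j : Fin N) : List (Fin N) → (NCPoly N →ₗ[ℂ] NCPoly N)
  | [] => LinearMap.id
  | k :: b => (-(Q.entry j k * Q.wordWeight k b)) • (rann Q k ∘ₗ contract Q j b)

/-- Linear extension of `contract` in the contracted word. -/
noncomputable def contractLin (Q : QMatrix N) (j : Fin N) :
    NCPoly N →ₗ[ℂ] (NCPoly N →ₗ[ℂ] NCPoly N) :=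
  Finsupp.linearCombination ℂ (contract Q j)

/-- The sum over all factorizations `v = a j b` of the contractions of `b` into `x a`. -/
noncomputable def splitContract (Q : QMatrix N) (j : Fin N) :
    List (Fin N) → (NCPoly N →ₗ[ℂ] NCPoly N)
  | [] => 0
  | i :: v => (if i = j then contract Q j v else 0) + splitContract Q j v ∘ₗ rcr i

/-- Linear extension of `splitContract` in the word. -/
noncomputable def splitContractLin (Q : QMatrix N) (j : Fin N) :
    NCPoly N →ₗ[ℂ] (NCPoly N →ₗ[ℂ] NCPoly N) :=
  Finsupp.linearCombination ℂ (splitContract Q j)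

@[simp] theorem contractLin_word (Q : QMatrix N) (j : Fin N) (b : List (Fin N)) :
    contractLin Q j (word b) = contract Q j b := by
  simp [contractLin]

@[simp] theorem splitContractLin_word (Q : QMatrix N) (j : Fin N) (b : List (Fin N)) :
    splitContractLin Q j (word b) = splitContract Q j b := by
  simp [splitContractLin]

theorem contractLin_lcr (Q : QMatrix N) (j k : Fin N) (y : NCPoly N) :
    contractLin Q j (lcr k y) =
      (-Q.entry j k) • (rann Q k ∘ₗ contractLin Q j (diagWeight Q k y)) := by
  have : contractLin Q j ∘ₗ lcr k = (-Q.entry j k) •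
      (LinearMap.llcomp ℂ (NCPoly N) (NCPoly N) (NCPoly N) (rann Q k) ∘ₗ
        contractLin Q j ∘ₗ diagWeight Q k) := by
    refine hom_ext_word (M := NCPoly N →ₗ[ℂ] NCPoly N) fun b => ?_
    refine DFunLike.ext _ _ fun x => ?_
    simp only [LinearMap.comp_apply, LinearMap.smul_apply, lcr_word, contractLin_word,
      diagWeight_word, map_smul, LinearMap.llcomp_apply, contract, smul_smul, neg_mul]
  exact congrArg (fun T => T y) this

theorem splitContractLin_lcr (Q : QMatrix N) (j i : Fin N) (y x : NCPoly N) :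
    splitContractLin Q j (lcr i y) x =
      (if i = j then contractLin Q j y x else 0) + splitContractLin Q j y (rcr i x) := by
  have : splitContractLin Q j ∘ₗ lcr i =
      (if i = j then contractLin Q j else 0) +
        (LinearMap.lcomp ℂ (NCPoly N) (rcr i) ∘ₗ splitContractLin Q j) := by
    refine hom_ext_word (M := NCPoly N →ₗ[ℂ] NCPoly N) fun b => ?_
    refine DFunLike.ext _ _ fun x => ?_
    simp only [LinearMap.comp_apply, LinearMap.add_apply, lcr_word, splitContractLin_word,
      splitContract, LinearMap.lcomp_apply]
    split_ifs <;> simp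
  have := congrArg (fun T => T y x) this
  split_ifs at this ⊢ <;> simpa only [LinearMap.comp_apply, LinearMap.add_apply,
    LinearMap.zero_apply, LinearMap.lcomp_apply] using this

theorem contract_diagWeight (Q : QMatrix N) (j i : Fin N) (b : List (Fin N)) (x : NCPoly N) :
    contract Q j b (diagWeight Q i x) = Q.wordWeight i b • diagWeight Q i (contract Q j b x) := by
  induction b with
  | nil => simp [contract]
  | cons k b ih =>
    simp only [contract, LinearMap.smul_apply, LinearMap.comp_apply, ih, map_smul,
      rann_diagWeight, smul_smul, QMatrix.wordWeight_cons]
    congr 1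
    ring

theorem contract_lann (Q : QMatrix N) (j i : Fin N) (b : List (Fin N)) (x : NCPoly N) :
    contract Q j b (lann Q i x) = lann Q i (contract Q j b x) := by
  induction b with
  | nil => simp [contract]
  | cons k b ih =>
    simp only [contract, LinearMap.smul_apply, LinearMap.comp_apply, ih, map_smul, lann_rann]

/-- The weights in `contract` are chosen for this identity. Moving l_i past the annihilator of a
letter `k = i` leaves a diagonal operator, and that operator commutes through the remaining
contraction at the price of the word weight already present in the coefficient. The defects assemble
into the contraction of l_i^* b. -/
theorem contract_lcr (Q : QMatrix N) (j i : Fin N) (b : List (Fin N)) (x : NCPoly N) :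
    contract Q j b (lcr i x) = lcr i (contract Q j b x) -
      Q.entry i j • contractLin Q j (lann Q i (word b)) (diagWeight Q i x) := by
  induction b with
  | nil => simp [contract]
  | cons k b ih =>
    have h := lann_diagWeight Q i k (word b)
    rw [diagWeight_word, map_smul] at h
    have h2 : Q.entry i k • contractLin Q j (lcr k (lann Q i (word b))) =
        (-(Q.entry j k * Q.wordWeight k b)) •
          (rann Q k ∘ₗ contractLin Q j (lann Q i (word b))) := by
      rw [contractLin_lcr, smul_comm, ← LinearMap.comp_smul, ← map_smul, Q.entry_comm i k, ← h,
        map_smul, LinearMap.comp_smul, smul_smul, neg_mul]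
    rw [lann_cons, map_add, map_smul, h2]
    have h3 : rann Q k (lcr i (contract Q j b x)) = lcr i (rann Q k (contract Q j b x)) +
        if k = i then diagWeight Q i (contract Q j b x) else 0 := by
      rw [rann_lcr]
      by_cases hk : k = i
      · simp [hk]
      · simp [hk, Ne.symm hk]
    simp only [contract, LinearMap.smul_apply, LinearMap.comp_apply, ih, map_sub, map_smul, h3,
      LinearMap.add_apply]
    split_ifs with hk
    · subst hk
      rw [contractLin_word, contract_diagWeight, Q.entry_comm j k]
      module
    · rw [map_zero, LinearMap.zero_apply]
      module

theorem contract_field (Q : QMatrix N) (j i : Fin N) (b : List (Fin N)) (x : NCPoly N) :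
    contract Q j b (field Q i x) +
      Q.entry i j • contractLin Q j (lann Q i (word b)) (diagWeight Q i x) =
      field Q i (contract Q j b x) := by
  rw [field_apply, field_apply, map_add, contract_lcr, contract_lann]
  abel

/-- The invariant behind the commutator of D_j with X_i. It is stated for an arbitrary vector `x`
because the induction on `v` moves the first letter to the right end of `x`. The defect of moving
that letter past the field operator is cancelled by the term of l_i^* v deleting it. -/
theorem splitContract_field (Q : QMatrix N) (j i : Fin N) (v : List (Fin N)) (x : NCPoly N) :
    splitContract Q j v (field Q i x) +
      splitContractLin Q j (lann Q i (word v)) (diagWeight Q i x) =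
      field Q i (splitContract Q j v x) := by
  induction v generalizing x with
  | nil => simp [splitContract]
  | cons k v ih =>
    have h1 : rcr k (field Q i x) = field Q i (rcr k x) - if i = k then diagWeight Q i x else 0 := by
      rw [field_rcr, add_sub_cancel_right]
    have h2 : splitContract Q j (k :: v) (field Q i x) =
        (if k = j then contract Q j v (field Q i x) else 0) +
          (splitContract Q j v (field Q i (rcr k x)) -
            if i = k then splitContract Q j v (diagWeight Q i x) else 0) := by
      simp only [splitContract, LinearMap.add_apply, LinearMap.comp_apply, h1, map_sub]
      split_ifs <;> simp
    have h3 : splitContractLin Q j (lann Q i (word (k :: v))) (diagWeight Q i x) =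
        (if i = k then splitContract Q j v (diagWeight Q i x) else 0) +
          ((if k = j then
            Q.entry i j • contractLin Q j (lann Q i (word v)) (diagWeight Q i x) else 0) +
          splitContractLin Q j (lann Q i (word v)) (diagWeight Q i (rcr k x))) := by
      rw [lann_cons, map_add, map_smul, LinearMap.add_apply, LinearMap.smul_apply,
        splitContractLin_lcr, diagWeight_rcr, map_smul, smul_add]
      congr 1
      · by_cases h : i = k
        · simp [h]
        · simp [h, Ne.symm h]
      · congr 1
        split_ifs with h
        · rw [h]
        · rw [smul_zero]
    have h4 : field Q i (splitContract Q j (k :: v) x) =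
        (if k = j then contract Q j v (field Q i x) +
          Q.entry i j • contractLin Q j (lann Q i (word v)) (diagWeight Q i x) else 0) +
        field Q i (splitContract Q j v (rcr k x)) := by
      simp only [splitContract, LinearMap.add_apply, LinearMap.comp_apply, map_add]
      split_ifs
      · rw [contract_field]
      · simp
    rw [h2, h3, h4, ← ih]
    split_ifs <;> abel

/-- The dual operator `D_j`, determined by `[D_j, X_i] = δ_{ij} P_Ω` and `D_j Ω = 0`. -/
noncomputable def dualOp (Q : QMatrix N) (j : Fin N) : NCPoly N →ₗ[ℂ] NCPoly N :=
  (splitContractLin Q j).flip (word [])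

theorem contractLin_vacuum (Q : QMatrix N) (j : Fin N) (y : NCPoly N) :
    contractLin Q j y (word []) = y [] • word [] := by
  refine eq_of_word_induction (S := (contractLin Q j).flip (word []))
    (T := (LinearMap.toSpanSingleton ℂ _ (word [])) ∘ₗ Finsupp.lapply []) (by simp [contract])
    ?_ y
  intro i u ih
  have hu : contract Q j u (word []) = (word u : NCPoly N) [] • word [] := by simpa using ih
  simp only [LinearMap.flip_apply, lcr_word, contractLin_word, contract, LinearMap.smul_apply,
    LinearMap.comp_apply, hu, map_smul, rann_nil]
  simp

/-- At the vacuum `splitContract_field` loses its diagonal weight and accounts for everything except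
the factorization of `i :: v` with empty prefix. That one contracts `v` into Ω, which survives only
for empty `v` and gives P_Ω. -/
theorem dualOp_field (Q : QMatrix N) (j i : Fin N) (y : NCPoly N) :
    dualOp Q j (field Q i y) = field Q i (dualOp Q j y) + if i = j then y [] • word [] else 0 := by
  have h1 := fun u => splitContract_field Q j i u (word [])
  have h2 : splitContractLin Q j y (field Q i (word [])) +
      splitContractLin Q j (lann Q i y) (word []) = field Q i (splitContractLin Q j y (word [])) := by
    have : (splitContractLin Q j).flip (field Q i (word [])) +
        (splitContractLin Q j).flip (word []) ∘ₗ lann Q i =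
        field Q i ∘ₗ (splitContractLin Q j).flip (word []) :=
      hom_ext_word fun u => by simpa [diagWeight_word] using h1 u
    exact congrArg (fun T => T y) this
  have h3 : field Q i (word []) = rcr i (word []) := by simp [field_apply]
  simp only [dualOp, LinearMap.flip_apply]
  rw [← h2, h3, field_apply, map_add, LinearMap.add_apply, splitContractLin_lcr,
    contractLin_vacuum]
  abel

/-- `(τ_Q ⊗ τ_Q)(∂_j Y_u)` for a word `u`. -/
noncomputable def diffMoment (Q : QMatrix N) (j : Fin N) (u : List (Fin N)) : ℂ :=
  ∑ k : Fin u.length, if u.get k = j then moment Q (u.take k) * moment Q (u.drop (k + 1)) else 0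

/-- Each time D_j passes a letter equal to `j`, the commutator projects the vector of the remaining
suffix onto the vacuum, leaving its moment. -/
theorem dualOp_toVector (Q : QMatrix N) (j : Fin N) (u : List (Fin N)) :
    dualOp Q j (toVector Q (word u)) = ∑ k : Fin u.length, if u.get k = j then
      moment Q (u.drop (k + 1)) • toVector Q (word (u.take k)) else 0 := by
  induction u with
  | nil => simp [dualOp, splitContract]
  | cons i u ih =>
    rw [toVector_cons, dualOp_field, ih, add_comm, map_sum]
    refine Eq.trans ?_ (Fin.sum_univ_succ (n := u.length) fun k : Fin (u.length + 1) =>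
      if (i :: u).get k = j then
        moment Q ((i :: u).drop (k + 1)) • toVector Q (word ((i :: u).take k)) else 0).symm
    congr 1
    · simp [moment]
    · refine Finset.sum_congr rfl fun k _ => ?_
      simp only [List.get_cons_succ', Fin.val_succ, List.drop_succ_cons, List.take_succ_cons]
      split_ifs
      · rw [map_smul, toVector_cons]
      · rw [map_zero]

/-- The functional `⟨D_j^* Ω, ·⟩`, i.e. the coefficient of the vacuum in `D_j`. -/
noncomputable def conjFunctional (Q : QMatrix N) (j : Fin N) : NCPoly N →ₗ[ℂ] ℂ :=
  Finsupp.lapply [] ∘ₗ dualOp Q j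

theorem conjFunctional_toVector (Q : QMatrix N) (j : Fin N) (u : List (Fin N)) :
    conjFunctional Q j (toVector Q (word u)) = diffMoment Q j u := by
  simp only [conjFunctional, LinearMap.comp_apply, dualOp_toVector, diffMoment, Finsupp.lapply_apply,
    Finsupp.finsetSum_apply]
  refine Finset.sum_congr rfl fun k _ => ?_
  split_ifs
  · simp [moment, mul_comm]
  · simp

/-! ### Estimates in weighted ℓ¹-norms. -/

theorem QMatrix.norm_entry_le (Q : QMatrix N) (i j : Fin N) : ‖Q.entry i j‖ ≤ Q.maxAbs := by
  rw [QMatrix.entry, Complex.norm_real, Real.norm_eq_abs]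
  exact le_ciSup (f := fun p : Fin N × Fin N => |Q.coef p.1 p.2|) (Set.finite_range _).bddAbove
    (i, j)

theorem QMatrix.maxAbs_nonneg (Q : QMatrix N) : 0 ≤ Q.maxAbs :=
  Real.iSup_nonneg fun _ => abs_nonneg _

theorem QMatrix.maxAbs_lt_one (Q : QMatrix N) : Q.maxAbs < 1 := by
  rcases isEmpty_or_nonempty (Fin N × Fin N) with h | h
  · rw [QMatrix.maxAbs, Real.iSup_of_isEmpty]; exact one_pos
  · obtain ⟨p, hp⟩ := exists_eq_ciSup_of_finite (f := fun p : Fin N × Fin N => |Q.coef p.1 p.2|)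
    rw [QMatrix.maxAbs, ← hp]
    exact Q.abs_lt_one _ _

theorem QMatrix.norm_wordWeight_le (Q : QMatrix N) (i : Fin N) (v : List (Fin N)) :
    ‖Q.wordWeight i v‖ ≤ Q.maxAbs ^ v.length := by
  induction v with
  | nil => simp
  | cons k v ih =>
    rw [QMatrix.wordWeight_cons, norm_mul, List.length_cons, pow_succ']
    exact mul_le_mul (Q.norm_entry_le i k) ih (norm_nonneg _) Q.maxAbs_nonneg

/-- The weighted `ℓ¹`-norm `∑_w |x_w| ρ^{|w|}` of a polynomial. -/
noncomputable def wnorm (ρ : ℝ) (x : NCPoly N) : ℝ := x.sum fun u c => ‖c‖ * ρ ^ u.length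

section wnorm

variable {ρ σ : ℝ}

theorem wnorm_nonneg (hρ : 0 ≤ ρ) (x : NCPoly N) : 0 ≤ wnorm ρ x :=
  Finset.sum_nonneg fun _ _ => by positivity

@[simp] theorem wnorm_zero : wnorm ρ (0 : NCPoly N) = 0 := by simp [wnorm]

@[simp] theorem wnorm_word (u : List (Fin N)) : wnorm ρ (word u) = ρ ^ u.length := by
  simp [wnorm]

theorem wnorm_eq_sum {x : NCPoly N} {s : Finset (List (Fin N))} (h : x.support ⊆ s) :
    wnorm ρ x = ∑ u ∈ s, ‖x u‖ * ρ ^ u.length :=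
  Finsupp.sum_of_support_subset _ h _ (by simp)

theorem wnorm_smul (c : ℂ) (x : NCPoly N) : wnorm ρ (c • x) = ‖c‖ * wnorm ρ x := by
  rw [wnorm_eq_sum (Finsupp.support_smul (b := c) (g := x)), wnorm_eq_sum subset_rfl,
    Finset.mul_sum]
  exact Finset.sum_congr rfl fun u _ => by simp [mul_assoc]

theorem wnorm_neg (x : NCPoly N) : wnorm ρ (-x) = wnorm ρ x := by
  rw [← neg_one_smul ℂ x, wnorm_smul]; simp

theorem wnorm_add_le (hρ : 0 ≤ ρ) (x y : NCPoly N) : wnorm ρ (x + y) ≤ wnorm ρ x + wnorm ρ y := by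
  classical
  rw [wnorm_eq_sum (Finsupp.support_add (g₁ := x) (g₂ := y)),
    wnorm_eq_sum (x := x) (Finset.subset_union_left (s₂ := y.support)),
    wnorm_eq_sum (x := y) (Finset.subset_union_right (s₁ := x.support)),
    ← Finset.sum_add_distrib]
  refine Finset.sum_le_sum fun u _ => ?_
  rw [← add_mul]
  exact mul_le_mul_of_nonneg_right (norm_add_le _ _) (by positivity)

theorem wnorm_sub_le (hρ : 0 ≤ ρ) (x y : NCPoly N) : wnorm ρ (x - y) ≤ wnorm ρ x + wnorm ρ y := by
  rw [sub_eq_add_neg, ← wnorm_neg y]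
  exact wnorm_add_le hρ x (-y)

theorem wnorm_sum_le (hρ : 0 ≤ ρ) {ι : Type*} (s : Finset ι) (f : ι → NCPoly N) :
    wnorm ρ (∑ i ∈ s, f i) ≤ ∑ i ∈ s, wnorm ρ (f i) := by
  classical
  induction s using Finset.induction_on with
  | empty => simp
  | insert i s hi ih =>
    rw [Finset.sum_insert hi, Finset.sum_insert hi]
    exact (wnorm_add_le hρ _ _).trans (by gcongr)

theorem norm_apply_le_wnorm (hρ : 0 ≤ ρ) (x : NCPoly N) (u : List (Fin N)) :
    ‖x u‖ * ρ ^ u.length ≤ wnorm ρ x := by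
  classical
  rw [wnorm_eq_sum (Finset.subset_insert u x.support)]
  exact Finset.single_le_sum (f := fun u => ‖x u‖ * ρ ^ u.length)
    (fun _ _ => by positivity) (Finset.mem_insert_self u _)

theorem wnorm_linearCombination_le (hρ : 0 ≤ ρ) {C : ℝ} {f : List (Fin N) → NCPoly N}
    (h : ∀ u, wnorm ρ (f u) ≤ C * σ ^ u.length) (x : NCPoly N) :
    wnorm ρ (Finsupp.linearCombination ℂ f x) ≤ C * wnorm σ x := by
  have hx : wnorm σ x = ∑ u ∈ x.support, ‖x u‖ * σ ^ u.length := rfl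
  rw [Finsupp.linearCombination_apply, Finsupp.sum, hx, Finset.mul_sum]
  refine (wnorm_sum_le hρ _ _).trans (Finset.sum_le_sum fun u _ => ?_)
  rw [wnorm_smul]
  calc ‖x u‖ * wnorm ρ (f u) ≤ ‖x u‖ * (C * σ ^ u.length) := by gcongr; exact h u
    _ = _ := by ring

theorem wnorm_map_le (hρ : 0 ≤ ρ) {C : ℝ} {T : NCPoly N →ₗ[ℂ] NCPoly N}
    (h : ∀ u, wnorm ρ (T (word u)) ≤ C * σ ^ u.length) (x : NCPoly N) :
    wnorm ρ (T x) ≤ C * wnorm σ x := by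
  have hT : T = Finsupp.linearCombination ℂ (fun u => T (word u)) := hom_ext_word fun u => by simp
  rw [hT]
  exact wnorm_linearCombination_le hρ h x

theorem wnorm_lcr_le (hρ : 0 ≤ ρ) (i : Fin N) (x : NCPoly N) :
    wnorm ρ (lcr i x) ≤ ρ * wnorm ρ x :=
  wnorm_map_le hρ (fun u => by simp [pow_succ']) x

theorem wnorm_rcr_le (hρ : 0 ≤ ρ) (i : Fin N) (x : NCPoly N) :
    wnorm ρ (rcr i x) ≤ ρ * wnorm ρ x :=
  wnorm_map_le hρ (fun u => by simp [pow_succ']) x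

/-- Each position of `u` is removed by exactly one `i`, and removing the m-th letter costs at most
q^{m-1}. The geometric series therefore bounds the sum over all `i` without a factor N. -/
theorem sum_wnorm_lann_word_le (hρ : 0 < ρ) (Q : QMatrix N) (u : List (Fin N)) :
    ∑ i, wnorm ρ (lann Q i (word u)) ≤ ((1 - Q.maxAbs) * ρ)⁻¹ * ρ ^ u.length := by
  have hq : 0 < 1 - Q.maxAbs := sub_pos.2 Q.maxAbs_lt_one
  induction u with
  | nil => simp only [lann_nil, wnorm_zero, Finset.sum_const_zero]; positivity
  | cons k u ih =>
    have h : ∀ i, wnorm ρ (lann Q i (word (k :: u))) ≤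
        (if k = i then ρ ^ u.length else 0) + Q.maxAbs * (ρ * wnorm ρ (lann Q i (word u))) := by
      intro i
      rw [lann_cons]
      refine (wnorm_add_le hρ.le _ _).trans (add_le_add ?_ ?_)
      · split_ifs <;> simp
      · rw [wnorm_smul]
        exact mul_le_mul (Q.norm_entry_le _ _) (wnorm_lcr_le hρ.le _ _) (wnorm_nonneg hρ.le _)
          Q.maxAbs_nonneg
    refine (Finset.sum_le_sum fun i _ => h i).trans ?_
    rw [Finset.sum_add_distrib, Finset.sum_ite_eq, if_pos (Finset.mem_univ k), ← Finset.mul_sum,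
      ← Finset.mul_sum]
    have := Q.maxAbs_nonneg
    calc ρ ^ u.length + Q.maxAbs * (ρ * ∑ i, wnorm ρ (lann Q i (word u)))
        ≤ ρ ^ u.length + Q.maxAbs * (ρ * (((1 - Q.maxAbs) * ρ)⁻¹ * ρ ^ u.length)) := by gcongr
      _ = ((1 - Q.maxAbs) * ρ)⁻¹ * ρ ^ (k :: u).length := by
        rw [List.length_cons, pow_succ]; field_simp; ring

theorem wnorm_lann_le (hρ : 0 < ρ) (Q : QMatrix N) (i : Fin N) (x : NCPoly N) :
    wnorm ρ (lann Q i x) ≤ ((1 - Q.maxAbs) * ρ)⁻¹ * wnorm ρ x := by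
  refine wnorm_map_le hρ.le (fun u => le_trans ?_ (sum_wnorm_lann_word_le hρ Q u)) x
  exact Finset.single_le_sum (f := fun i => wnorm ρ (lann Q i (word u)))
    (fun _ _ => wnorm_nonneg hρ.le _) (Finset.mem_univ i)

/-- The constant is a partial geometric sum and not its limit: a new first letter is farthest from
the right end, so the induction adds precisely the term q^{|u|}. -/
theorem wnorm_rann_word_le (hρ : 0 < ρ) (Q : QMatrix N) (k : Fin N) (u : List (Fin N)) :
    wnorm ρ (rann Q k (word u)) ≤
      ((1 - Q.maxAbs ^ u.length) * ((1 - Q.maxAbs) * ρ)⁻¹) * ρ ^ u.length := by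
  have hq : 0 < 1 - Q.maxAbs := sub_pos.2 Q.maxAbs_lt_one
  induction u with
  | nil => simp
  | cons i u ih =>
    rw [← lcr_word, rann_lcr]
    have h : wnorm ρ (if i = k then diagWeight Q k (word u) else 0) ≤
        Q.maxAbs ^ u.length * ρ ^ u.length := by
      have := Q.maxAbs_nonneg
      split_ifs
      · rw [diagWeight_word, wnorm_smul, wnorm_word]
        gcongr
        exact Q.norm_wordWeight_le k u
      · rw [wnorm_zero]; positivity
    refine (wnorm_add_le hρ.le _ _).trans ((add_le_add
      ((wnorm_lcr_le hρ.le _ _).trans (mul_le_mul_of_nonneg_left ih hρ.le)) h).trans_eq ?_)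
    rw [List.length_cons, pow_succ, pow_succ]
    field_simp
    ring

theorem wnorm_rann_le (hρ : 0 < ρ) (Q : QMatrix N) (k : Fin N) (x : NCPoly N) :
    wnorm ρ (rann Q k x) ≤ ((1 - Q.maxAbs) * ρ)⁻¹ * wnorm ρ x := by
  have hq : 0 < 1 - Q.maxAbs := sub_pos.2 Q.maxAbs_lt_one
  refine wnorm_map_le hρ.le (fun u => (wnorm_rann_word_le hρ Q k u).trans ?_) x
  refine mul_le_mul_of_nonneg_right (mul_le_of_le_one_left (by positivity) ?_) (by positivity)
  have := pow_nonneg Q.maxAbs_nonneg u.length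
  linarith

/-- One contraction costs q / ((1-q)σ), and the hypothesis says that this is at most σ. The radius σ
balances the cost of contracting a letter against that of keeping it. -/
theorem wnorm_contract_le (hσ : 0 < σ) (Q : QMatrix N)
    (h : Q.maxAbs * (1 - Q.maxAbs)⁻¹ ≤ σ ^ 2) (j : Fin N) (b : List (Fin N)) (x : NCPoly N) :
    wnorm σ (contract Q j b x) ≤ σ ^ b.length * wnorm σ x := by
  have hq : 0 < 1 - Q.maxAbs := sub_pos.2 Q.maxAbs_lt_one
  induction b with
  | nil => simp [contract]
  | cons k b ih =>
    have h0 := Q.maxAbs_nonneg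
    have h1 : ‖-(Q.entry j k * Q.wordWeight k b)‖ ≤ Q.maxAbs := by
      rw [norm_neg, norm_mul]
      refine (mul_le_of_le_one_right (norm_nonneg _) ?_).trans (Q.norm_entry_le j k)
      exact (Q.norm_wordWeight_le k b).trans (pow_le_one₀ h0 Q.maxAbs_lt_one.le)
    have h2 : Q.maxAbs * ((1 - Q.maxAbs) * σ)⁻¹ ≤ σ := by
      rw [mul_inv, ← mul_assoc, ← div_eq_mul_inv _ σ, div_le_iff₀ hσ, ← sq]
      exact h
    rw [contract, LinearMap.smul_apply, LinearMap.comp_apply, wnorm_smul]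
    have hx := wnorm_nonneg hσ.le (contract Q j b x)
    calc _ ≤ Q.maxAbs * (((1 - Q.maxAbs) * σ)⁻¹ * wnorm σ (contract Q j b x)) :=
          mul_le_mul h1 (wnorm_rann_le hσ Q k _) (wnorm_nonneg hσ.le _) h0
      _ = (Q.maxAbs * ((1 - Q.maxAbs) * σ)⁻¹) * wnorm σ (contract Q j b x) := by ring
      _ ≤ σ * (σ ^ b.length * wnorm σ x) := by gcongr
      _ = _ := by rw [List.length_cons, pow_succ']; ring

/-- The length bounds the number of positions of `j`; the factor σ on the left stands for the
deleted letter `j` and avoids the exponent `v.length - 1`. -/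
theorem wnorm_splitContract_le (hσ : 0 < σ) (Q : QMatrix N)
    (h : Q.maxAbs * (1 - Q.maxAbs)⁻¹ ≤ σ ^ 2) (j : Fin N) (v : List (Fin N)) (x : NCPoly N) :
    σ * wnorm σ (splitContract Q j v x) ≤ v.length * σ ^ v.length * wnorm σ x := by
  induction v generalizing x with
  | nil => simp [splitContract]
  | cons i v ih =>
    have h1 : wnorm σ ((if i = j then contract Q j v else 0) x) ≤ σ ^ v.length * wnorm σ x := by
      split_ifs
      · exact wnorm_contract_le hσ Q h j v x
      · have := wnorm_nonneg hσ.le x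
        rw [LinearMap.zero_apply, wnorm_zero]; positivity
    rw [splitContract, LinearMap.add_apply, LinearMap.comp_apply, List.length_cons]
    calc _ ≤ σ * (σ ^ v.length * wnorm σ x + wnorm σ (splitContract Q j v (rcr i x))) := by
          gcongr
          exact (wnorm_add_le hσ.le _ _).trans (by gcongr)
      _ ≤ σ ^ (v.length + 1) * wnorm σ x + v.length * σ ^ v.length * (σ * wnorm σ x) := by
          rw [mul_add, pow_succ']
          refine add_le_add (by rw [mul_assoc]) ((ih _).trans ?_)
          gcongr
          exact wnorm_rcr_le hσ.le i x
      _ = _ := by push_cast; ring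

theorem norm_conjFunctional_le (hσ : 0 < σ) (Q : QMatrix N)
    (h : Q.maxAbs * (1 - Q.maxAbs)⁻¹ ≤ σ ^ 2) (j : Fin N) (v : List (Fin N)) :
    σ * ‖conjFunctional Q j (word v)‖ ≤ v.length * σ ^ v.length := by
  have := wnorm_splitContract_le hσ Q h j v (word [])
  rw [wnorm_word, List.length_nil, pow_zero, mul_one] at this
  refine le_trans ?_ this
  gcongr
  simpa [conjFunctional, dualOp] using
    norm_apply_le_wnorm hσ.le (splitContract Q j v (word [])) []

theorem conjFunctional_nil (Q : QMatrix N) (j : Fin N) : conjFunctional Q j (word []) = 0 := by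
  simp [conjFunctional, dualOp, splitContract]

theorem conjFunctional_singleton (Q : QMatrix N) (j k : Fin N) :
    conjFunctional Q j (word [k]) = if k = j then 1 else 0 := by
  by_cases h : k = j <;> simp [conjFunctional, dualOp, splitContract, contract, h]

end wnorm

/-! ### Inverting the gauge operator P_Ω + ∑ l_i l_i^*. -/

/-- The self-adjoint operator `P_Ω + ∑_i l_i l_i^*`. -/
noncomputable def gaugeOp (Q : QMatrix N) : NCPoly N →ₗ[ℂ] NCPoly N :=
  LinearMap.toSpanSingleton ℂ _ (word []) ∘ₗ Finsupp.lapply [] + ∑ i, lcr i ∘ₗ lann Q i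

theorem gaugeOp_apply (Q : QMatrix N) (x : NCPoly N) :
    gaugeOp Q x = x [] • word [] + ∑ i, lcr i (lann Q i x) := by
  simp [gaugeOp, LinearMap.sum_apply]

theorem gaugeOp_apply_cons (Q : QMatrix N) (x : NCPoly N) (i : Fin N) (v : List (Fin N)) :
    gaugeOp Q x (i :: v) = lann Q i x v := by
  simp [gaugeOp_apply, lcr_apply_cons]

theorem gaugeOp_cons (Q : QMatrix N) (k : Fin N) (v : List (Fin N)) :
    gaugeOp Q (word (k :: v)) =
      word (k :: v) + ∑ i, Q.entry i k • lcr i (lcr k (lann Q i (word v))) := by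
  have e : ∑ i, lcr i (if k = i then word v else 0) = word (k :: v) := by
    rw [Finset.sum_eq_single_of_mem k (Finset.mem_univ k)
      (fun i _ hi => by rw [if_neg hi.symm, map_zero]), if_pos rfl, lcr_word]
  have e' : (word (k :: v) : NCPoly N) [] = 0 := Finsupp.single_eq_of_ne (by simp)
  rw [gaugeOp_apply, e', zero_smul, zero_add]
  conv_rhs => rw [← e]
  rw [← Finset.sum_add_distrib]
  refine Finset.sum_congr rfl fun i _ => ?_
  rw [lann_cons, map_add, map_smul]

theorem gaugeOp_nil (Q : QMatrix N) : gaugeOp Q (word []) = word [] := by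
  rw [gaugeOp_apply, Finsupp.single_eq_same, one_smul]
  simp only [lann_nil, map_zero, Finset.sum_const_zero, add_zero]

theorem gaugeOp_singleton (Q : QMatrix N) (k : Fin N) : gaugeOp Q (word [k]) = word [k] := by
  rw [gaugeOp_cons]
  simp only [lann_nil, map_zero, smul_zero, Finset.sum_const_zero, add_zero]

/-- Deleting the first letter and putting it back reproduces the word; deleting any later letter
first passes `k`, which gives the factor q. The sum over `i` is absorbed by
`sum_wnorm_lann_word_le`, so the bound does not depend on N. -/
theorem wnorm_gaugeOp_word_sub_le {ρ : ℝ} (hρ : 0 < ρ) (Q : QMatrix N) (u : List (Fin N)) :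
    wnorm ρ (gaugeOp Q (word u) - word u) ≤ Q.maxAbs * (1 - Q.maxAbs)⁻¹ * ρ ^ u.length := by
  have hq : 0 < 1 - Q.maxAbs := sub_pos.2 Q.maxAbs_lt_one
  have h0 := Q.maxAbs_nonneg
  cases u with
  | nil =>
    rw [gaugeOp_nil, sub_self, wnorm_zero]
    positivity
  | cons k v =>
    rw [gaugeOp_cons, add_sub_cancel_left]
    refine (wnorm_sum_le hρ.le _ _).trans ?_
    calc _ ≤ ∑ i, Q.maxAbs * (ρ * (ρ * wnorm ρ (lann Q i (word v)))) := by
          refine Finset.sum_le_sum fun i _ => ?_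
          rw [wnorm_smul]
          refine mul_le_mul (Q.norm_entry_le _ _) ?_ (wnorm_nonneg hρ.le _) h0
          exact (wnorm_lcr_le hρ.le _ _).trans
            (mul_le_mul_of_nonneg_left (wnorm_lcr_le hρ.le _ _) hρ.le)
      _ ≤ Q.maxAbs * (ρ * (ρ * (((1 - Q.maxAbs) * ρ)⁻¹ * ρ ^ v.length))) := by
          simp only [← Finset.mul_sum]
          gcongr
          exact sum_wnorm_lann_word_le hρ Q v
      _ = _ := by rw [List.length_cons, pow_succ]; field_simp

theorem wnorm_gaugeOp_sub_le {ρ : ℝ} (hρ : 0 < ρ) (Q : QMatrix N) (x : NCPoly N) :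
    wnorm ρ (gaugeOp Q x - x) ≤ Q.maxAbs * (1 - Q.maxAbs)⁻¹ * wnorm ρ x := by
  have h : ∀ u, wnorm ρ ((gaugeOp Q - LinearMap.id : NCPoly N →ₗ[ℂ] NCPoly N) (word u)) ≤
      Q.maxAbs * (1 - Q.maxAbs)⁻¹ * ρ ^ u.length := fun u => by
    rw [LinearMap.sub_apply, LinearMap.id_apply]
    exact wnorm_gaugeOp_word_sub_le hρ Q u
  have := wnorm_map_le hρ.le h x
  rwa [LinearMap.sub_apply, LinearMap.id_apply] at this

theorem wnorm_le_gaugeOp {ρ : ℝ} (hρ : 0 < ρ) (Q : QMatrix N) (x : NCPoly N) :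
    (1 - Q.maxAbs * (1 - Q.maxAbs)⁻¹) * wnorm ρ x ≤ wnorm ρ (gaugeOp Q x) := by
  have h1 := wnorm_gaugeOp_sub_le hρ Q x
  have h2 := wnorm_sub_le hρ.le (gaugeOp Q x) (gaugeOp Q x - x)
  rw [sub_sub_cancel] at h2
  linarith

/-- The homogeneous polynomials of degree `n`. -/
noncomputable def level (N n : ℕ) : Submodule ℂ (NCPoly N) :=
  Submodule.span ℂ (word '' {u : List (Fin N) | u.length = n})

instance (n : ℕ) : FiniteDimensional ℂ (level N n) :=
  FiniteDimensional.span_of_finite ℂ ((List.finite_length_eq (Fin N) n).image _)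

theorem word_mem_level (u : List (Fin N)) : (word u : NCPoly N) ∈ level N u.length :=
  Submodule.subset_span ⟨u, rfl, rfl⟩

theorem map_mem_level {n m : ℕ} {T : NCPoly N →ₗ[ℂ] NCPoly N}
    (h : ∀ u : List (Fin N), u.length = n → T (word u) ∈ level N m) {x : NCPoly N}
    (hx : x ∈ level N n) : T x ∈ level N m := by
  have : level N n ≤ (level N m).comap T :=
    Submodule.span_le.2 (by rintro _ ⟨u, hu, rfl⟩; exact h u hu)
  exact this hx

theorem lcr_mem_level {n : ℕ} (i : Fin N) {x : NCPoly N} (hx : x ∈ level N n) :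
    lcr i x ∈ level N (n + 1) :=
  map_mem_level (fun u hu => by
    rw [lcr_word, ← hu]; exact word_mem_level (i :: u)) hx

theorem lcr_lann_word_mem_level (Q : QMatrix N) (i k : Fin N) (u : List (Fin N)) :
    lcr k (lann Q i (word u)) ∈ level N u.length := by
  induction u generalizing k with
  | nil => simp
  | cons l u ih =>
    rw [lann_cons, map_add, map_smul]
    refine Submodule.add_mem _ ?_ (Submodule.smul_mem _ _ (lcr_mem_level k (ih l)))
    split_ifs
    · exact lcr_mem_level k (word_mem_level u)
    · simp

theorem gaugeOp_mem_level (Q : QMatrix N) {n : ℕ} {x : NCPoly N} (hx : x ∈ level N n) :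
    gaugeOp Q x ∈ level N n := by
  refine map_mem_level (fun u hu => ?_) hx
  subst hu
  rw [gaugeOp_apply]
  refine Submodule.add_mem _ ?_ (Submodule.sum_mem _ fun i _ => lcr_lann_word_mem_level Q i i u)
  cases u with
  | nil => exact Submodule.smul_mem _ _ (word_mem_level [])
  | cons k u => simp

theorem eq_zero_of_wnorm_le {x : NCPoly N} (h : wnorm 1 x ≤ 0) : x = 0 := by
  ext u
  have := (norm_apply_le_wnorm zero_le_one x u).trans h
  simpa using this

/-- Injectivity is the lower norm bound. Surjectivity follows because the finite-dimensional
homogeneous pieces are preserved, so no completion is needed and the inverse acts on polynomials. -/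
theorem gaugeOp_bijective (Q : QMatrix N) (hQ : Q.maxAbs * (1 - Q.maxAbs)⁻¹ < 1) :
    Function.Bijective (gaugeOp Q) := by
  have hinj : Function.Injective (gaugeOp Q) := by
    rw [← LinearMap.ker_eq_bot, LinearMap.ker_eq_bot']
    intro x hx
    have := wnorm_le_gaugeOp one_pos Q x
    rw [hx, wnorm_zero] at this
    exact eq_zero_of_wnorm_le (nonpos_of_mul_nonpos_right this (sub_pos.2 hQ))
  have hsurj : ∀ u, ∃ z, gaugeOp Q z = word u := by
    intro u
    let T : level N u.length →ₗ[ℂ] level N u.length :=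
      (gaugeOp Q).restrict fun x hx => gaugeOp_mem_level Q hx
    have hT : Function.Injective T := fun x y h =>
      Subtype.ext (hinj (congrArg Subtype.val h))
    have hT' : Function.Surjective T := 
      LinearMap.surjective_of_injective (K := ℂ) (V := level N u.length) (f := T) hT
    obtain ⟨z, hz⟩ := hT' ⟨word u, word_mem_level u⟩
    exact ⟨z, congrArg Subtype.val hz⟩
  refine ⟨hinj, fun y => ?_⟩
  change y ∈ LinearMap.range (gaugeOp Q)
  induction y using Finsupp.induction_linear with
  | zero => exact Submodule.zero_mem _
  | add x y hx hy => exact Submodule.add_mem _ hx hy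
  | single u c =>
    have : (Finsupp.single u c : NCPoly N) = c • word u := by simp
    rw [this]
    exact Submodule.smul_mem _ _ (hsurj u)

/-! ### Comparison with the Fock space, and the dual basis. -/

theorem annihilate_create_of_ne (Q : QMatrix N) {i k : Fin N} (hik : k ≠ i) (x : PreFock Q) :
    annihilate Q i (create Q k x) = (Q.coef i k : ℂ) • create Q k (annihilate Q i x) := by
  induction x using PreFock.induction with
  | h0 => simp
  | hadd x x' hx hx' => simp only [map_add, hx, hx', smul_add]
  | hs c u =>
    simp only [map_smul]
    rw [smul_comm _ c]
    congr 1
    obtain ⟨n, v⟩ := u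
    simp only [create, annihilate, PreFock.lift_e, annihilateWord]
    rw [Fin.sum_univ_succ, Fin.cons_zero, if_neg hik, zero_add]
    cases n with
    | zero => simp
    | succ n =>
      simp only [map_sum, Finset.smul_sum]
      refine Finset.sum_congr rfl fun m _ => ?_
      simp only [Fin.cons_succ]
      by_cases h : v m = i
      · simp only [h, if_true, map_smul, PreFock.lift_e]
        rw [smul_smul]
        congr 1
        · rw [Fin.prod_univ_succ]
          simp
        · congr 1
          congr 1
          ext l
          refine Fin.cases ?_ (fun l => ?_) l
          · simp
          · simp
      · simp [h]

theorem annihilate_create_eq (Q : QMatrix N) (i k : Fin N) (x : PreFock Q) :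
    annihilate Q i (create Q k x) =
      (if k = i then x else 0) + Q.entry i k • create Q k (annihilate Q i x) := by
  by_cases h : k = i
  · subst h
    rw [if_pos rfl]
    exact annihilate_create Q k x
  · rw [if_neg h, zero_add]
    exact annihilate_create_of_ne Q h x

/-- The identification of polynomials with the algebraic Fock space that sends the word
`i_1 ⋯ i_n` to `e_{i_1} ⊗ ⋯ ⊗ e_{i_n}`. -/
noncomputable def toPreFock (Q : QMatrix N) : NCPoly N →ₗ[ℂ] PreFock Q :=
  Finsupp.linearCombination ℂ fun u => PreFock.e Q ⟨u.length, u.get⟩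

theorem toPreFock_word (Q : QMatrix N) (u : List (Fin N)) :
    toPreFock Q (word u) = PreFock.e Q ⟨u.length, u.get⟩ := by
  simp [toPreFock]

theorem create_toPreFock_word (Q : QMatrix N) (i : Fin N) (u : List (Fin N)) :
    create Q i (toPreFock Q (word u)) = toPreFock Q (word (i :: u)) := by
  rw [toPreFock_word, toPreFock_word, create, PreFock.lift_e]
  congr 1
  refine Sigma.ext rfl (heq_of_eq (funext fun k => ?_))
  refine Fin.cases rfl (fun k => rfl) k

theorem toPreFock_lcr (Q : QMatrix N) (i : Fin N) (x : NCPoly N) :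
    toPreFock Q (lcr i x) = create Q i (toPreFock Q x) := by
  have : toPreFock Q ∘ₗ lcr i = create Q i ∘ₗ toPreFock Q := hom_ext_word fun u => by
    simp only [LinearMap.comp_apply, lcr_word, create_toPreFock_word]
  exact congrArg (fun T => T x) this

theorem toPreFock_lann (Q : QMatrix N) (i : Fin N) (x : NCPoly N) :
    toPreFock Q (lann Q i x) = annihilate Q i (toPreFock Q x) := by
  refine eq_of_word_induction (S := toPreFock Q ∘ₗ lann Q i)
    (T := annihilate Q i ∘ₗ toPreFock Q) ?_ ?_ x
  · simp only [LinearMap.comp_apply, lann_nil, map_zero, toPreFock_word]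
    rw [annihilate, PreFock.lift_e]
    rfl
  · intro k u ih
    simp only [LinearMap.comp_apply] at ih ⊢
    rw [lann_lcr, map_add, map_smul, toPreFock_lcr, toPreFock_lcr, annihilate_create_eq, ih]
    split_ifs <;> simp

/-- The `Q`-inner product on polynomials. -/
noncomputable def form (Q : QMatrix N) (x y : NCPoly N) : ℂ :=
  inner ℂ (toPreFock Q x) (toPreFock Q y)

theorem form_lcr_left (Q : QMatrix N) (i : Fin N) (x y : NCPoly N) :
    form Q (lcr i x) y = form Q x (lann Q i y) := by
  rw [form, form, toPreFock_lcr, toPreFock_lann, inner_create_left]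

theorem form_conj (Q : QMatrix N) (x y : NCPoly N) : conj (form Q y x) = form Q x y :=
  inner_conj_symm _ _

theorem form_lann_left (Q : QMatrix N) (i : Fin N) (x y : NCPoly N) :
    form Q (lann Q i x) y = form Q x (lcr i y) := by
  rw [← form_conj, ← form_lcr_left, form_conj]

theorem form_add_left (Q : QMatrix N) (x x' y : NCPoly N) :
    form Q (x + x') y = form Q x y + form Q x' y := by
  simp [form, inner_add_left]

theorem form_smul_left (Q : QMatrix N) (c : ℂ) (x y : NCPoly N) :
    form Q (c • x) y = conj c * form Q x y := by
  simp [form, inner_smul_left]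

theorem form_field_left (Q : QMatrix N) (i : Fin N) (x y : NCPoly N) :
    form Q (field Q i x) y = form Q x (field Q i y) := by
  rw [field_apply, form_add_left, form_lcr_left, form_lann_left, field_apply]
  simp [form, inner_add_right, add_comm]

theorem gram_nil (Q : QMatrix N) : gram Q ⟨0, Fin.elim0⟩ ⟨0, Fin.elim0⟩ = 1 := by
  rw [gram_level, Fintype.sum_eq_single 1 (fun σ hσ => absurd (Subsingleton.elim σ 1) hσ),
    if_pos (Subsingleton.elim _ _)]
  simp [invWeight]

theorem form_nil_left (Q : QMatrix N) (y : NCPoly N) : form Q (word []) y = y [] := by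
  have := eq_of_word_induction (S := (innerₛₗ ℂ (toPreFock Q (word []))) ∘ₗ toPreFock Q)
    (T := Finsupp.lapply []) ?_ ?_ y
  · exact this
  · change inner ℂ (toPreFock Q (word [])) (toPreFock Q (word [])) = (word [] : NCPoly N) []
    rw [toPreFock_word, PreFock.inner_e, Finsupp.single_eq_same]
    have : (⟨([] : List (Fin N)).length, ([] : List (Fin N)).get⟩ : FockIndex N) =
      ⟨0, Fin.elim0⟩ := Sigma.ext rfl (heq_of_eq (funext fun k => Fin.elim0 k))
    rw [this, gram_nil, Complex.ofReal_one]
  · intro i u _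
    change form Q (word []) (lcr i (word u)) = lcr i (word u) []
    rw [← form_lann_left, lann_nil, lcr_apply_nil]
    simp [form]

theorem form_sum_left (Q : QMatrix N) {ι : Type*} (s : Finset ι) (f : ι → NCPoly N)
    (y : NCPoly N) : form Q (∑ i ∈ s, f i) y = ∑ i ∈ s, form Q (f i) y := by
  simp [form, sum_inner]

theorem form_gaugeOp_left (Q : QMatrix N) (x y : NCPoly N) :
    form Q (gaugeOp Q x) y = form Q x (gaugeOp Q y) := by
  have h : ∀ x y : NCPoly N, form Q (gaugeOp Q x) y =
      conj (x []) * y [] + ∑ i, form Q (lann Q i x) (lann Q i y) := by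
    intro x y
    rw [gaugeOp_apply, form_add_left, form_smul_left, form_nil_left, form_sum_left]
    simp only [form_lcr_left]
  rw [h, ← form_conj, h, map_add, map_sum, map_mul, Complex.conj_conj, mul_comm]
  simp only [form_conj]

/-- The inverse of `gaugeOp`, when it exists. -/
noncomputable def gaugeInv (Q : QMatrix N) : NCPoly N →ₗ[ℂ] NCPoly N := by
  classical
  exact if h : Function.Bijective (gaugeOp Q) then
    (LinearEquiv.ofBijective (gaugeOp Q) h).symm.toLinearMap else 0

theorem gaugeOp_gaugeInv (Q : QMatrix N) (hQ : Q.maxAbs * (1 - Q.maxAbs)⁻¹ < 1) (x : NCPoly N) :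
    gaugeOp Q (gaugeInv Q x) = x := by
  rw [gaugeInv, dif_pos (gaugeOp_bijective Q hQ)]
  exact (LinearEquiv.ofBijective (gaugeOp Q) (gaugeOp_bijective Q hQ)).apply_symm_apply x

theorem wnorm_gaugeInv_le {ρ : ℝ} (hρ : 0 < ρ) (Q : QMatrix N)
    (hQ : Q.maxAbs * (1 - Q.maxAbs)⁻¹ < 1) (x : NCPoly N) :
    wnorm ρ (gaugeInv Q x) ≤ (1 - Q.maxAbs * (1 - Q.maxAbs)⁻¹)⁻¹ * wnorm ρ x := by
  have := wnorm_le_gaugeOp hρ Q (gaugeInv Q x)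
  rw [gaugeOp_gaugeInv Q hQ] at this
  rwa [inv_mul_eq_div, le_div_iff₀ (sub_pos.2 hQ), mul_comm]

/-- The basis dual to the words with respect to the `Q`-inner product. -/
noncomputable def dualVec (Q : QMatrix N) : List (Fin N) → NCPoly N
  | [] => word []
  | i :: v => gaugeInv Q (lcr i (dualVec Q v))

/-- With G the gauge operator and y = Gz, symmetry of G and adjointness reduce the pairing with
`dualVec Q (i :: v)` to the `v`-coefficient of l_i^* z, and this is the `i :: v`-coefficient of Gz =
y by `gaugeOp_apply_cons`. -/
theorem form_dualVec (Q : QMatrix N) (hQ : Q.maxAbs * (1 - Q.maxAbs)⁻¹ < 1) (v : List (Fin N))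
    (y : NCPoly N) : form Q (dualVec Q v) y = y v := by
  induction v generalizing y with
  | nil => exact form_nil_left Q y
  | cons i v ih =>
    conv_lhs => rw [← gaugeOp_gaugeInv Q hQ y]
    rw [← form_gaugeOp_left, dualVec, gaugeOp_gaugeInv Q hQ, form_lcr_left, ih,
      ← gaugeOp_apply_cons, gaugeOp_gaugeInv Q hQ]

theorem dualVec_singleton (Q : QMatrix N) (hQ : Q.maxAbs * (1 - Q.maxAbs)⁻¹ < 1) (k : Fin N) :
    dualVec Q [k] = word [k] := by
  refine (gaugeOp_bijective Q hQ).injective ?_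
  rw [dualVec, gaugeOp_gaugeInv Q hQ, gaugeOp_singleton, dualVec, lcr_word]

theorem wnorm_dualVec_le {ρ : ℝ} (hρ : 0 < ρ) (Q : QMatrix N)
    (hQ : Q.maxAbs * (1 - Q.maxAbs)⁻¹ < 1) (v : List (Fin N)) :
    wnorm ρ (dualVec Q v) ≤ ((1 - Q.maxAbs * (1 - Q.maxAbs)⁻¹)⁻¹ * ρ) ^ v.length := by
  have h0 : 0 ≤ (1 - Q.maxAbs * (1 - Q.maxAbs)⁻¹)⁻¹ := inv_nonneg.2 (sub_pos.2 hQ).le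
  induction v with
  | nil => simp [dualVec]
  | cons i v ih =>
    rw [dualVec, List.length_cons, pow_succ']
    refine (wnorm_gaugeInv_le hρ Q hQ _).trans ?_
    rw [mul_assoc]
    gcongr
    refine (wnorm_lcr_le hρ.le _ _).trans ?_
    gcongr

/-! ### The Wick map. -/

/-- Approximations to the Wick product map, exact on words of length at most `n`. -/
noncomputable def wickAux (Q : QMatrix N) : ℕ → (NCPoly N →ₗ[ℂ] NCPoly N)
  | 0 => LinearMap.id
  | n + 1 => Finsupp.linearCombination ℂ fun u => match u with
    | [] => word []
    | i :: v => lcr i (wickAux Q n (word v)) - wickAux Q n (lann Q i (word v))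

theorem wickAux_nil (Q : QMatrix N) (n : ℕ) : wickAux Q n (word []) = word [] := by
  cases n <;> simp [wickAux]

theorem wickAux_succ_cons (Q : QMatrix N) (n : ℕ) (i : Fin N) (v : List (Fin N)) :
    wickAux Q (n + 1) (word (i :: v)) =
      lcr i (wickAux Q n (word v)) - wickAux Q n (lann Q i (word v)) := by
  simp [wickAux]

theorem lann_word_mem_level (Q : QMatrix N) (i : Fin N) {n : ℕ} {u : List (Fin N)}
    (hu : u.length = n + 1) : lann Q i (word u) ∈ level N n := by
  induction n generalizing u with
  | zero =>
    obtain ⟨k, rfl⟩ := List.length_eq_one_iff.1 hu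
    rw [lann_cons, lann_nil, map_zero, smul_zero, add_zero]
    split_ifs
    · exact word_mem_level []
    · exact Submodule.zero_mem _
  | succ n ih =>
    obtain ⟨k, v, rfl⟩ := List.exists_cons_of_length_eq_add_one hu
    have hv : v.length = n + 1 := by simpa using hu
    rw [lann_cons]
    refine Submodule.add_mem _ ?_ (Submodule.smul_mem _ _ (lcr_mem_level k (ih hv)))
    split_ifs
    · rw [← hv]; exact word_mem_level v
    · exact Submodule.zero_mem _

theorem eqOn_level {n : ℕ} {S T : NCPoly N →ₗ[ℂ] NCPoly N}
    (h : ∀ u : List (Fin N), u.length = n → S (word u) = T (word u)) {x : NCPoly N}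
    (hx : x ∈ level N n) : S x = T x := by
  refine LinearMap.eqOn_span (f := S) (g := T) ?_ hx
  rintro _ ⟨u, hu, rfl⟩
  exact h u hu

/-- The Wick recursion calls itself on l_i^* v, a combination of shorter words, so it runs on a step
counter instead of the word. The counter is immaterial once it reaches the length. -/
theorem wickAux_eq (Q : QMatrix N) {n m : ℕ} {u : List (Fin N)} (hn : u.length ≤ n)
    (hm : u.length ≤ m) : wickAux Q n (word u) = wickAux Q m (word u) := by
  induction h : u.length using Nat.strong_induction_on generalizing n m u with
  | _ l ih =>
    cases u with
    | nil => rw [wickAux_nil, wickAux_nil]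
    | cons i v =>
      obtain ⟨n, rfl⟩ : ∃ k, n = k + 1 := ⟨n - 1, by simp at hn; omega⟩
      obtain ⟨m, rfl⟩ : ∃ k, m = k + 1 := ⟨m - 1, by simp at hm; omega⟩
      simp only [List.length_cons, Nat.add_le_add_iff_right] at hn hm h
      rw [wickAux_succ_cons, wickAux_succ_cons, ih v.length (by omega) hn hm rfl]
      congr 1
      rcases v with _ | ⟨k, v⟩
      · simp
      · refine eqOn_level (n := v.length) (fun w hw => ?_) (lann_word_mem_level Q i rfl)
        simp only [List.length_cons] at hn hm h
        exact ih w.length (by omega) (by omega) (by omega) rfl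

/-- The Wick product map, inverse to `P ↦ P(X) Ω`. -/
noncomputable def wick (Q : QMatrix N) : NCPoly N →ₗ[ℂ] NCPoly N :=
  Finsupp.linearCombination ℂ fun u => wickAux Q u.length (word u)

theorem wick_word (Q : QMatrix N) (u : List (Fin N)) :
    wick Q (word u) = wickAux Q u.length (word u) := by
  simp [wick]

theorem wick_nil (Q : QMatrix N) : wick Q (word []) = word [] := by
  rw [wick_word, wickAux_nil]

theorem wick_lcr (Q : QMatrix N) (i : Fin N) (x : NCPoly N) :
    wick Q (lcr i x) = lcr i (wick Q x) - wick Q (lann Q i x) := by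
  have : wick Q ∘ₗ lcr i = lcr i ∘ₗ wick Q - wick Q ∘ₗ lann Q i := by
    refine hom_ext_word fun u => ?_
    simp only [LinearMap.comp_apply, LinearMap.sub_apply, lcr_word]
    rw [wick_word, List.length_cons, wickAux_succ_cons, wick_word]
    congr 1
    rcases u with _ | ⟨k, v⟩
    · simp
    · refine eqOn_level (n := v.length) (fun w hw => ?_) (lann_word_mem_level Q i rfl)
      rw [wick_word]
      exact wickAux_eq Q (by simp; omega) le_rfl
  exact congrArg (fun T => T x) this

/-- Together with `toVector_lcr` this intertwines X_i with multiplication by Y_i, which makes the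
two maps mutually inverse. -/
theorem wick_field (Q : QMatrix N) (i : Fin N) (x : NCPoly N) :
    wick Q (field Q i x) = lcr i (wick Q x) := by
  rw [field_apply, map_add, wick_lcr, sub_add_cancel]

theorem wick_toVector (Q : QMatrix N) (x : NCPoly N) : wick Q (toVector Q x) = x := by
  refine eq_of_word_induction (S := wick Q ∘ₗ toVector Q) (T := LinearMap.id)
    (by simp [wick_nil]) (fun i u ih => ?_) x
  simp only [LinearMap.comp_apply, LinearMap.id_apply] at ih ⊢
  rw [toVector_lcr, wick_field, ih]

/-- Words satisfy a property as soon as it passes from the homogeneous pieces `v` and `l_i^* v`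
to `i v`. -/
theorem word_strong_induction {p : List (Fin N) → Prop} (h0 : p [])
    (hc : ∀ i v, p v → (∀ w : List (Fin N), w.length + 1 = v.length → p w) → p (i :: v))
    (u : List (Fin N)) : p u := by
  induction h : u.length using Nat.strong_induction_on generalizing u with
  | _ l ih =>
    cases u with
    | nil => exact h0
    | cons i v =>
      simp only [List.length_cons] at h
      exact hc i v (ih v.length (by omega) v rfl) fun w hw => ih w.length (by omega) w rfl

theorem toVector_wick (Q : QMatrix N) (x : NCPoly N) : toVector Q (wick Q x) = x := by
  have : toVector Q ∘ₗ wick Q = LinearMap.id := by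
    refine hom_ext_word fun u => ?_
    simp only [LinearMap.comp_apply, LinearMap.id_apply]
    induction u using word_strong_induction with
    | h0 => rw [wick_nil, toVector_nil]
    | hc i v hv hw =>
      have h : toVector Q (wick Q (lann Q i (word v))) = lann Q i (word v) := by
        rcases v with _ | ⟨k, v⟩
        · simp
        · exact eqOn_level (n := v.length) (S := toVector Q ∘ₗ wick Q) (T := LinearMap.id)
            (fun w h => hw w (by simp [h])) (lann_word_mem_level Q i rfl)
      rw [← lcr_word, wick_lcr, map_sub, toVector_lcr, hv, h, field_apply, add_sub_cancel_right]
  exact congrArg (fun T => T x) this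

/-- One step of the recursion multiplies the bound by R + 1/((1-q)α): a multiplication by Y_i
measured at radius R and a left annihilation measured at radius α. The hypothesis keeps this below
the α allotted to one letter. -/
theorem wnorm_wickAux_le {R α : ℝ} (hR : 0 ≤ R) (hα : 0 < α) (Q : QMatrix N)
    (h : R + ((1 - Q.maxAbs) * α)⁻¹ ≤ α) (n : ℕ) (x : NCPoly N) :
    wnorm R (wickAux Q n x) ≤ wnorm α x := by
  have hq : 0 < 1 - Q.maxAbs := sub_pos.2 Q.maxAbs_lt_one
  have hi : 0 < ((1 - Q.maxAbs) * α)⁻¹ := by positivity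
  rw [← one_mul (wnorm α x)]
  refine wnorm_map_le hR (fun u => ?_) x
  rw [one_mul]
  clear x
  induction n generalizing u with
  | zero =>
    simp only [wickAux, LinearMap.id_apply, wnorm_word]
    exact pow_le_pow_left₀ hR (by linarith) _
  | succ n ih =>
    cases u with
    | nil => rw [wickAux_nil]; simp
    | cons i v =>
      have ih' : ∀ x, wnorm R (wickAux Q n x) ≤ wnorm α x := fun x => by
        rw [← one_mul (wnorm α x)]
        exact wnorm_map_le hR (fun u => by rw [one_mul]; exact ih u) x
      rw [wickAux_succ_cons, List.length_cons, pow_succ']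
      calc _ ≤ R * α ^ v.length + ((1 - Q.maxAbs) * α)⁻¹ * α ^ v.length := by
            refine (wnorm_sub_le hR _ _).trans (add_le_add ?_ ?_)
            · exact (wnorm_lcr_le hR _ _).trans (mul_le_mul_of_nonneg_left (ih v) hR)
            · refine (ih' _).trans ?_
              simpa using wnorm_lann_le hα Q i (word v)
        _ = (R + ((1 - Q.maxAbs) * α)⁻¹) * α ^ v.length := by ring
        _ ≤ _ := by gcongr

theorem wnorm_wick_le {R α : ℝ} (hR : 0 ≤ R) (hα : 0 < α) (Q : QMatrix N)
    (h : R + ((1 - Q.maxAbs) * α)⁻¹ ≤ α) (x : NCPoly N) :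
    wnorm R (wick Q x) ≤ wnorm α x := by
  rw [← one_mul (wnorm α x)]
  refine wnorm_map_le hR (fun u => ?_) x
  rw [wick_word, one_mul]
  simpa using wnorm_wickAux_le hR hα Q h u.length (word u)

/-- The converse trade of radii: R dominates the norm of a field operator on the ℓ¹-space of radius
ρ. -/
theorem wnorm_toVector_word_le {R ρ : ℝ} (hρ : 0 < ρ) (Q : QMatrix N)
    (h : ρ + ((1 - Q.maxAbs) * ρ)⁻¹ ≤ R) (w : List (Fin N)) :
    wnorm ρ (toVector Q (word w)) ≤ R ^ w.length := by
  have hq : 0 < 1 - Q.maxAbs := sub_pos.2 Q.maxAbs_lt_one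
  have hi : 0 < ((1 - Q.maxAbs) * ρ)⁻¹ := by positivity
  have hR : 0 ≤ R := by linarith
  induction w with
  | nil => simp
  | cons i w ih =>
    have h0 := wnorm_nonneg hρ.le (toVector Q (word w))
    rw [toVector_cons, field_apply, List.length_cons, pow_succ']
    calc _ ≤ ρ * wnorm ρ (toVector Q (word w)) +
          ((1 - Q.maxAbs) * ρ)⁻¹ * wnorm ρ (toVector Q (word w)) :=
        (wnorm_add_le hρ.le _ _).trans
          (add_le_add (wnorm_lcr_le hρ.le _ _) (wnorm_lann_le hρ Q _ _))
      _ = (ρ + ((1 - Q.maxAbs) * ρ)⁻¹) * wnorm ρ (toVector Q (word w)) := by ring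
      _ ≤ _ := by gcongr

theorem norm_moment_le {R ρ : ℝ} (hρ : 0 < ρ) (Q : QMatrix N)
    (h : ρ + ((1 - Q.maxAbs) * ρ)⁻¹ ≤ R) (w : List (Fin N)) : ‖moment Q w‖ ≤ R ^ w.length := by
  refine le_trans ?_ (wnorm_toVector_word_le hρ Q h w)
  simpa [moment] using norm_apply_le_wnorm hρ.le (toVector Q (word w)) []

theorem form_toVector_word (Q : QMatrix N) (w u : List (Fin N)) :
    form Q (toVector Q (word w)) (toVector Q (word u)) = moment Q (w.reverse ++ u) := by
  induction w generalizing u with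
  | nil => rw [toVector_nil, form_nil_left]; rfl
  | cons i w ih =>
    rw [toVector_cons, form_field_left, ← toVector_cons, ih]
    simp

theorem conj_moment_reverse (Q : QMatrix N) (w : List (Fin N)) :
    conj (moment Q w.reverse) = moment Q w := by
  have h1 := form_toVector_word Q w []
  have h2 := form_toVector_word Q [] w
  rw [List.append_nil] at h1
  rw [← h1, form_conj, h2]
  rfl

theorem conj_moment (Q : QMatrix N) (w : List (Fin N)) :
    conj (moment Q w) = moment Q w.reverse := by
  rw [← conj_moment_reverse, Complex.conj_conj]

/-! ### Symmetries of the functionals u ↦ (τ⊗τ)(∂_j u). -/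

/-- The sum of `g a b` over the factorizations `u = a j b` of a word. -/
def splitSum (j : Fin N) : (List (Fin N) → List (Fin N) → ℂ) → List (Fin N) → ℂ
  | _, [] => 0
  | g, i :: u => (if i = j then g [] u else 0) + splitSum j (fun a b => g (i :: a) b) u

theorem splitSum_eq_sum (j : Fin N) (g : List (Fin N) → List (Fin N) → ℂ) (u : List (Fin N)) :
    splitSum j g u =
      ∑ k : Fin u.length, if u.get k = j then g (u.take k) (u.drop (k + 1)) else 0 := by
  induction u generalizing g with
  | nil => simp [splitSum]
  | cons i u ih =>
    rw [splitSum, ih]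
    exact (Fin.sum_univ_succ (n := u.length) fun k : Fin (u.length + 1) =>
      if (i :: u).get k = j then g ((i :: u).take k) ((i :: u).drop (k + 1)) else 0).symm

theorem splitSum_append_singleton (j i : Fin N) (g : List (Fin N) → List (Fin N) → ℂ)
    (u : List (Fin N)) : splitSum j g (u ++ [i]) =
      splitSum j (fun a b => g a (b ++ [i])) u + if i = j then g u [] else 0 := by
  induction u generalizing g with
  | nil => simp [splitSum]
  | cons k u ih => rw [List.cons_append, splitSum, ih, splitSum, add_assoc]

theorem splitSum_reverse (j : Fin N) (g : List (Fin N) → List (Fin N) → ℂ)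
    (u : List (Fin N)) : splitSum j g u.reverse =
      splitSum j (fun a b => g b.reverse a.reverse) u := by
  induction u generalizing g with
  | nil => rfl
  | cons k u ih =>
    rw [List.reverse_cons, splitSum_append_singleton, ih, splitSum, add_comm]
    simp

theorem conj_splitSum (j : Fin N) (g : List (Fin N) → List (Fin N) → ℂ) (u : List (Fin N)) :
    conj (splitSum j g u) = splitSum j (fun a b => conj (g a b)) u := by
  induction u generalizing g with
  | nil => simp [splitSum]
  | cons i u ih =>
    rw [splitSum, map_add, ih, splitSum]
    split_ifs <;> simp

/-- Both sides sum `g` over the cuts u = a b. The left side gives the letter at the cut to the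
prefix and so misses the empty prefix; the right side gives it to the suffix and misses the empty
suffix. -/
theorem sum_splitSum_telescope (g : List (Fin N) → List (Fin N) → ℂ) (u : List (Fin N)) :
    ∑ i, splitSum i (fun a b => g (a ++ [i]) b) u + g [] u =
      ∑ i, splitSum i (fun a b => g a (i :: b)) u + g u [] := by
  induction u generalizing g with
  | nil => simp [splitSum]
  | cons k u ih =>
    have := ih fun a b => g (k :: a) b
    simp only [splitSum, Finset.sum_add_distrib, Finset.sum_ite_eq, Finset.mem_univ, if_true,
      List.cons_append, List.nil_append]
    linear_combination this

theorem diffMoment_eq_splitSum (Q : QMatrix N) (j : Fin N) (u : List (Fin N)) :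
    diffMoment Q j u = splitSum j (fun a b => moment Q a * moment Q b) u := by
  rw [splitSum_eq_sum, diffMoment]

theorem conj_diffMoment (Q : QMatrix N) (j : Fin N) (u : List (Fin N)) :
    conj (diffMoment Q j u) = diffMoment Q j u.reverse := by
  rw [diffMoment_eq_splitSum, diffMoment_eq_splitSum, splitSum_reverse, conj_splitSum]
  simp only [map_mul, conj_moment, mul_comm]

/-- The moment form of ∑ [Y_i, ξ_i] = 0. Traciality moves `i` to the front or back of either factor,
after which the two sums differ by the telescoping identity. -/
theorem sum_diffMoment_cons (Q : QMatrix N) (u : List (Fin N)) :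
    ∑ i, diffMoment Q i (i :: u) = ∑ i, diffMoment Q i (u ++ [i]) := by
  have h := sum_splitSum_telescope (fun a b => moment Q a * moment Q b) u
  simp only [moment_append_singleton] at h
  simp only [diffMoment_eq_splitSum, splitSum_append_singleton, moment_append_singleton, splitSum,
    Finset.sum_add_distrib, if_true]
  simp only [moment_nil, one_mul, mul_one] at h ⊢
  rw [add_comm (Finset.sum _ _) (Finset.sum _ fun i => splitSum _ _ _)]
  congr 1
  linear_combination h

/-! ### Power series, pairings with moments, and uniqueness. -/

theorem hasSum_wnorm (R : ℝ) (x : NCPoly N) :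
    HasSum (fun w => ‖x w‖ * R ^ w.length) (wnorm R x) :=
  hasSum_sum_of_ne_finset_zero fun w hw => by
    rw [Finsupp.notMem_support_iff.1 hw, norm_zero, zero_mul]

/-- The superposition of a family of polynomials, as a power series. -/
noncomputable def superpose (h : List (Fin N) → NCPoly N) : NCSeries N := fun w => ∑' v, h v w

theorem NCSeries.rNorm_eq {R : ℝ} (hR : 0 ≤ R) (F : NCSeries N) :
    F.rNorm R = ∑' w, ENNReal.ofReal (‖F w‖ * R ^ w.length) := by
  refine tsum_congr fun w => ?_
  rw [ENNReal.ofReal_mul (norm_nonneg _), ofReal_norm, ENNReal.ofReal_pow hR]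

theorem NCSeries.rNorm_lt_top_iff {R : ℝ} (hR : 0 ≤ R) (F : NCSeries N) :
    F.rNorm R < ∞ ↔ Summable fun w => ‖F w‖ * R ^ w.length := by
  rw [NCSeries.rNorm_eq hR]
  constructor
  · intro h
    have := ENNReal.summable_toReal h.ne
    refine this.congr fun w => ?_
    rw [ENNReal.toReal_ofReal (by positivity)]
  · exact fun h => h.tsum_ofReal_ne_top.lt_top

/-- Tonelli's theorem; no summability is required, since a divergent coefficient sum has value 0 by
convention. -/
theorem rNorm_superpose_le {R : ℝ} (hR : 0 ≤ R) (h : List (Fin N) → NCPoly N) :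
    (superpose h).rNorm R ≤ ∑' v, ENNReal.ofReal (wnorm R (h v)) := by
  have h1 : ∀ v, ENNReal.ofReal (wnorm R (h v)) =
      ∑' w, ‖h v w‖ₑ * ENNReal.ofReal R ^ w.length := by
    intro v
    rw [← (hasSum_wnorm R (h v)).tsum_eq,
      ENNReal.ofReal_tsum_of_nonneg (fun w => by positivity) (hasSum_wnorm R (h v)).summable]
    exact (NCSeries.rNorm_eq hR (h v)).symm
  simp only [h1]
  rw [ENNReal.tsum_comm]
  refine ENNReal.tsum_le_tsum fun w => ?_
  rw [ENNReal.tsum_mul_right]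
  gcongr
  exact enorm_tsum_le_tsum_enorm

theorem superpose_pairing {R C : ℝ} (hR : 0 ≤ R) {h : List (Fin N) → NCPoly N}
    (hs : Summable fun v => wnorm R (h v)) {ψ : List (Fin N) → ℂ}
    (hψ : ∀ w, ‖ψ w‖ ≤ C * R ^ w.length) :
    ∑' w, superpose h w * ψ w = ∑' v, ∑' w, h v w * ψ w := by
  have hb : Summable (Function.uncurry fun v w => h v w * ψ w) := by
    have h1 : Summable fun p : List (Fin N) × List (Fin N) => ‖h p.1 p.2‖ * R ^ p.2.length := by
      rw [summable_prod_of_nonneg (fun p => by positivity)]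
      refine ⟨fun v => (hasSum_wnorm R (h v)).summable, ?_⟩
      simpa only [(hasSum_wnorm R (h _)).tsum_eq] using hs
    refine Summable.of_norm_bounded (h1.mul_left C) fun p => ?_
    simp only [Function.uncurry, norm_mul]
    calc _ ≤ ‖h p.1 p.2‖ * (C * R ^ p.2.length) := by gcongr; exact hψ _
      _ = _ := by ring
  rw [← hb.tsum_comm]
  exact tsum_congr fun w => tsum_mul_right.symm

theorem tsum_finsupp_mul (x : NCPoly N) (ψ : List (Fin N) → ℂ) :
    ∑' w, x w * ψ w = Finsupp.linearCombination ℂ ψ x := by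
  rw [Finsupp.linearCombination_apply, Finsupp.sum, tsum_eq_sum (s := x.support)]
  · simp
  · intro w hw
    rw [Finsupp.notMem_support_iff.1 hw, zero_mul]

theorem summable_mul_of_le {R C : ℝ} {F : NCSeries N}
    (hF : Summable fun w => ‖F w‖ * R ^ w.length) {ψ : List (Fin N) → ℂ}
    (hψ : ∀ w, ‖ψ w‖ ≤ C * R ^ w.length) : Summable fun w => F w * ψ w := by
  refine Summable.of_norm_bounded (hF.mul_left C) fun w => ?_
  rw [norm_mul]
  calc _ ≤ ‖F w‖ * (C * R ^ w.length) := by gcongr; exact hψ _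
    _ = _ := by ring

theorem form_toVector_left (Q : QMatrix N) (x : NCPoly N) (w : List (Fin N)) :
    form Q (toVector Q x) (toVector Q (word w)) =
      ∑ u ∈ x.support, conj (x u) * moment Q (u.reverse ++ w) := by
  conv_lhs => rw [← Finsupp.sum_single x, Finsupp.sum, map_sum, form_sum_left]
  refine Finset.sum_congr rfl fun u _ => ?_
  have : (Finsupp.single u (x u) : NCPoly N) = x u • word u := by simp
  rw [this, map_smul, form_smul_left, form_toVector_word]

/-- A power series that is orthogonal to all polynomials in the mixed `q`-Gaussian variables
vanishes. -/
theorem eq_zero_of_forall_pairing {R ρ r : ℝ} (hr : 0 < r) (hρ : 0 < ρ) (Q : QMatrix N)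
    (hQ : Q.maxAbs * (1 - Q.maxAbs)⁻¹ < 1)
    (hR : ρ + ((1 - Q.maxAbs) * ρ)⁻¹ ≤ R) (hrρ : r + ((1 - Q.maxAbs) * ρ)⁻¹ ≤ ρ)
    {F : NCSeries N} (hF : Summable fun w => ‖F w‖ * R ^ w.length)
    (h0 : ∀ u, ∑' w, F w * moment Q (u ++ w) = 0) : F = 0 := by
  have hq : 0 < 1 - Q.maxAbs := sub_pos.2 Q.maxAbs_lt_one
  have hR0 : 0 ≤ R := le_trans (by positivity) hR
  -- All coefficients of F(X)Ω vanish: the `v`-coefficient is the pairing with `dualVec Q v`, which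
  -- equals P(X)Ω for the polynomial P = `wick Q (dualVec Q v)`.
  have h1 : ∀ v, ∑' w, F w * toVector Q (word w) v = 0 := by
    intro v
    have e : ∀ w, F w * toVector Q (word w) v =
        ∑ u ∈ (wick Q (dualVec Q v)).support,
          F w * (conj (wick Q (dualVec Q v) u) * moment Q (u.reverse ++ w)) := by
      intro w
      rw [← form_dualVec Q hQ, ← toVector_wick Q (dualVec Q v), form_toVector_left,
        toVector_wick, Finset.mul_sum]
    simp only [e]
    have hs : ∀ u, Summable fun w => F w * moment Q (u ++ w) := fun u =>
      summable_mul_of_le (C := R ^ u.length) hF fun w => by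
        rw [← pow_add, ← List.length_append]
        exact norm_moment_le hρ Q hR _
    have hs' : ∀ (c : ℂ) u, ∀ w, F w * (c * moment Q (u ++ w)) = c * (F w * moment Q (u ++ w)) :=
      fun c u w => by ring
    rw [Summable.tsum_finsetSum]
    · refine Finset.sum_eq_zero fun u _ => ?_
      simp only [hs', tsum_mul_left, h0, mul_zero]
    · intro u _
      simp only [hs']
      exact (hs _).mul_left _
  funext u
  have hψ : ∀ v, ‖wick Q (word v) u‖ ≤ (r ^ u.length)⁻¹ * ρ ^ v.length := by
    intro v
    have := (norm_apply_le_wnorm hr.le (wick Q (word v)) u).trans (wnorm_wick_le hr.le hρ Q hrρ _)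
    rw [wnorm_word] at this
    rw [inv_mul_eq_div, le_div_iff₀ (by positivity)]
    exact this
  have hsum : Summable fun w => wnorm ρ (F w • toVector Q (word w)) := by
    refine Summable.of_nonneg_of_le (fun w => wnorm_nonneg hρ.le _) (fun w => ?_) hF
    rw [wnorm_smul]
    gcongr
    exact wnorm_toVector_word_le hρ Q hR w
  -- Applying the Wick map termwise recovers the coefficients of F from the vector F(X)Ω = 0. The
  -- interchange of sums uses three radii: R for F, ρ for the vector and r for the Wick polynomials.
  have key := superpose_pairing hρ.le hsum hψ
  have hz : superpose (fun w => F w • toVector Q (word w)) = 0 := by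
    funext v
    simpa [superpose] using h1 v
  have hl : ∀ w, ∑' v, (F w • toVector Q (word w)) v * wick Q (word v) u =
      F w * (word w : NCPoly N) u := by
    intro w
    conv_rhs => rw [← wick_toVector Q (word w)]
    rw [tsum_finsupp_mul, map_smul, smul_eq_mul]
    congr 1
    have : Finsupp.lapply u ∘ₗ wick Q =
        Finsupp.linearCombination ℂ (fun v => wick Q (word v) u) :=
      Finsupp.lhom_ext' fun u => LinearMap.ext_ring (by simp)
    exact (congrArg (fun T => T (toVector Q (word w))) this).symm
  simp only [hz, hl, Pi.zero_apply, zero_mul, tsum_zero] at key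
  rw [tsum_eq_single u (fun w hw => by rw [Finsupp.single_eq_of_ne hw.symm, mul_zero]),
    Finsupp.single_eq_same, mul_one] at key
  exact key.symm

theorem tsum_list_length (g : ℕ → ℝ≥0∞) :
    ∑' v : List (Fin N), g v.length = ∑' n, (N : ℝ≥0∞) ^ n * g n := by
  rw [← (List.equivSigmaTuple (α := Fin N)).symm.tsum_eq (fun v => g v.length)]
  have : ∀ p : (n : ℕ) × (Fin n → Fin N), g (List.equivSigmaTuple.symm p).length = g p.1 :=
    fun p => by simp [List.equivSigmaTuple]
  simp only [this]
  rw [ENNReal.tsum_sigma (fun n (_ : Fin n → Fin N) => g n)]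
  refine tsum_congr fun n => ?_
  rw [tsum_fintype, Finset.sum_const, Finset.card_univ, Fintype.card_fun, Fintype.card_fin,
    Fintype.card_fin, nsmul_eq_mul, Nat.cast_pow]

theorem summable_list_length {b : ℕ → ℝ} (hb : ∀ n, 0 ≤ b n)
    (hs : Summable fun n => (N : ℝ) ^ n * b n) : Summable fun v : List (Fin N) => b v.length := by
  have h : ∑' v : List (Fin N), ENNReal.ofReal (b v.length) ≠ ∞ := by
    rw [tsum_list_length (fun n => ENNReal.ofReal (b n))]
    have : ∀ n, (N : ℝ≥0∞) ^ n * ENNReal.ofReal (b n) = ENNReal.ofReal ((N : ℝ) ^ n * b n) :=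
      fun n => by
        rw [ENNReal.ofReal_mul (by positivity), ENNReal.ofReal_pow (by positivity),
          ENNReal.ofReal_natCast]
    simp only [this]
    exact hs.tsum_ofReal_ne_top
  exact (ENNReal.summable_toReal h).congr fun v => ENNReal.toReal_ofReal (hb _)

/-! ### The conjugate series: convergence, pairing and self-adjointness. -/

/-- The homogeneous expansion of the power series of the conjugate variable. -/
noncomputable def conjTerm (Q : QMatrix N) (j : Fin N) (v : List (Fin N)) : NCPoly N :=
  conj (conjFunctional Q j (word v)) • wick Q (dualVec Q v)

/-- The power series of the `j`-th conjugate variable. -/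
noncomputable def conjSeries (Q : QMatrix N) (j : Fin N) : NCSeries N := superpose (conjTerm Q j)

theorem wnorm_conjTerm_le {R α σ : ℝ} (hR : 0 ≤ R) (hα : 0 < α) (hσ : 0 < σ) (Q : QMatrix N)
    (hQ : Q.maxAbs * (1 - Q.maxAbs)⁻¹ < 1) (hRα : R + ((1 - Q.maxAbs) * α)⁻¹ ≤ α)
    (hQσ : Q.maxAbs * (1 - Q.maxAbs)⁻¹ ≤ σ ^ 2) (j : Fin N) (v : List (Fin N)) :
    wnorm R (conjTerm Q j v) ≤ σ⁻¹ * (v.length *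
      (σ * ((1 - Q.maxAbs * (1 - Q.maxAbs)⁻¹)⁻¹ * α)) ^ v.length) := by
  have h1 := norm_conjFunctional_le hσ Q hQσ j v
  have h2 := (wnorm_wick_le hR hα Q hRα (dualVec Q v)).trans (wnorm_dualVec_le hα Q hQ v)
  rw [conjTerm, wnorm_smul, RCLike.norm_conj]
  calc _ = σ⁻¹ * (σ * ‖conjFunctional Q j (word v)‖) * wnorm R (wick Q (dualVec Q v)) := by
        rw [inv_mul_cancel_left₀ hσ.ne']
    _ ≤ σ⁻¹ * (v.length * σ ^ v.length) *
        ((1 - Q.maxAbs * (1 - Q.maxAbs)⁻¹)⁻¹ * α) ^ v.length := by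
        have := wnorm_nonneg hR (wick Q (dualVec Q v))
        gcongr
    _ = _ := by rw [mul_pow]; ring

theorem summable_wnorm_conjTerm {R α σ : ℝ} (hR : 0 ≤ R) (hα : 0 < α) (hσ : 0 < σ) (Q : QMatrix N)
    (hQ : Q.maxAbs * (1 - Q.maxAbs)⁻¹ < 1) (hRα : R + ((1 - Q.maxAbs) * α)⁻¹ ≤ α)
    (hQσ : Q.maxAbs * (1 - Q.maxAbs)⁻¹ ≤ σ ^ 2)
    (hN : N * (σ * ((1 - Q.maxAbs * (1 - Q.maxAbs)⁻¹)⁻¹ * α)) < 1) (j : Fin N) :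
    Summable fun v => wnorm R (conjTerm Q j v) := by
  set y := σ * ((1 - Q.maxAbs * (1 - Q.maxAbs)⁻¹)⁻¹ * α) with hy
  have hy0 : 0 ≤ y := mul_nonneg hσ.le (mul_nonneg (inv_nonneg.2 (sub_pos.2 hQ).le) hα.le)
  refine Summable.of_nonneg_of_le (fun v => wnorm_nonneg hR _)
    (fun v => wnorm_conjTerm_le hR hα hσ Q hQ hRα hQσ j v) ?_
  refine summable_list_length (b := fun n => σ⁻¹ * (n * y ^ n)) (fun n => by positivity) ?_
  have h := (hasSum_coe_mul_geometric_of_norm_lt_one (𝕜 := ℝ) (r := N * y) (by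
    rwa [Real.norm_of_nonneg (by positivity)])).summable.mul_left σ⁻¹
  exact h.congr fun n => by rw [mul_pow]; ring

theorem rNorm_lt_top_of_summable {R : ℝ} (hR : 0 ≤ R) {h : List (Fin N) → NCPoly N}
    (hs : Summable fun v => wnorm R (h v)) : (superpose h).rNorm R < ∞ :=
  (rNorm_superpose_le hR h).trans_lt hs.tsum_ofReal_ne_top.lt_top

/-- Summing over `v`, the dual basis expands X_{u_n}⋯X_{u_1}Ω in words, so the total is the
conjugate of the functional of D_j on that vector; conjugation undoes the reversal. -/
theorem conjSeries_pairing {R ρ : ℝ} (hρ : 0 < ρ) (Q : QMatrix N)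
    (hQ : Q.maxAbs * (1 - Q.maxAbs)⁻¹ < 1) (hR : ρ + ((1 - Q.maxAbs) * ρ)⁻¹ ≤ R) {j : Fin N}
    (hs : Summable fun v => wnorm R (conjTerm Q j v)) (u : List (Fin N)) :
    ∑' w, conjSeries Q j w * moment Q (u ++ w) = diffMoment Q j u := by
  have hq : 0 < 1 - Q.maxAbs := sub_pos.2 Q.maxAbs_lt_one
  have hR0 : 0 ≤ R := le_trans (by positivity) hR
  rw [conjSeries, superpose_pairing (C := R ^ u.length) hR0 hs fun w => by
    rw [← pow_add, ← List.length_append]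
    exact norm_moment_le hρ Q hR _]
  have h1 : ∀ v, ∑' w, conjTerm Q j v w * moment Q (u ++ w) =
      conj (toVector Q (word u.reverse) v * conjFunctional Q j (word v)) := by
    intro v
    rw [← form_dualVec Q hQ v, ← toVector_wick Q (dualVec Q v), form_toVector_left,
      conjTerm, tsum_finsupp_mul, map_smul, Finsupp.linearCombination_apply,
      Finsupp.sum, map_mul, map_sum, smul_eq_mul, mul_comm]
    congr 1
    refine Finset.sum_congr rfl fun w _ => ?_
    rw [map_mul, Complex.conj_conj, conj_moment, List.reverse_append, List.reverse_reverse,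
      List.reverse_reverse, smul_eq_mul]
  simp only [h1]
  rw [← Complex.conj_tsum, tsum_finsupp_mul]
  have h2 : Finsupp.linearCombination ℂ (fun v => conjFunctional Q j (word v)) =
      conjFunctional Q j := hom_ext_word fun v => by simp
  rw [h2, conjFunctional_toVector, conj_diffMoment, List.reverse_reverse]

/-- F and its adjoint have the same pairings, by the symmetry of Φ and traciality, so uniqueness
makes them equal as formal series. -/
theorem selfAdjoint_of_pairing {R ρ r : ℝ} (hr : 0 < r) (hρ : 0 < ρ) (Q : QMatrix N)
    (hQ : Q.maxAbs * (1 - Q.maxAbs)⁻¹ < 1)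
    (hR : ρ + ((1 - Q.maxAbs) * ρ)⁻¹ ≤ R) (hrρ : r + ((1 - Q.maxAbs) * ρ)⁻¹ ≤ ρ)
    {F : NCSeries N} (hF : Summable fun w => ‖F w‖ * R ^ w.length) {Φ : List (Fin N) → ℂ}
    (hΦ : ∀ u, conj (Φ u) = Φ u.reverse) (h : ∀ u, ∑' w, F w * moment Q (u ++ w) = Φ u) :
    F.SelfAdjoint := by
  have hq : 0 < 1 - Q.maxAbs := sub_pos.2 Q.maxAbs_lt_one
  have hR0 : 0 ≤ R := le_trans (by positivity) hR
  let e : List (Fin N) ≃ List (Fin N) := List.reverse_involutive.toPerm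
  let G : NCSeries N := fun w => conj (F w.reverse)
  have hG : Summable fun w => ‖G w‖ * R ^ w.length := by
    refine (e.summable_iff.2 hF).congr fun w => ?_
    simp only [Function.comp_apply, e, Function.Involutive.coe_toPerm, List.length_reverse, G,
      RCLike.norm_conj]
  have hb : ∀ u w, ‖moment Q (u ++ w)‖ ≤ R ^ u.length * R ^ w.length := fun u w => by
    rw [← pow_add, ← List.length_append]
    exact norm_moment_le hρ Q hR _
  have hGm : ∀ u, ∑' w, G w * moment Q (u ++ w) = Φ u := by
    intro u
    rw [← List.reverse_reverse u, ← hΦ, ← h, Complex.conj_tsum, ← e.tsum_eq]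
    refine tsum_congr fun w => ?_
    simp only [e, Function.Involutive.coe_toPerm, G, List.reverse_reverse, map_mul, conj_moment,
      List.reverse_append]
    rw [moment_append_comm]
  have hz : F - G = 0 := by
    refine eq_zero_of_forall_pairing hr hρ Q hQ hR hrρ (F := F - G) ?_ fun u => ?_
    · refine Summable.of_nonneg_of_le (fun w => by positivity) (fun w => ?_) (hF.add hG)
      rw [← add_mul]
      gcongr
      exact norm_sub_le _ _
    · simp only [Pi.sub_apply, sub_mul]
      rw [(summable_mul_of_le hF (hb u)).tsum_sub (summable_mul_of_le hG (hb u)), h, hGm,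
        sub_self]
  intro w
  exact (sub_eq_zero.1 (congrFun hz w)).symm

/-! ### The cyclic potential. -/

theorem hasSum_list_cons {E : Type*} [AddCommMonoid E] [TopologicalSpace E] [ContinuousAdd E]
    {g : List (Fin N) → E} {a : Fin N → E} (h0 : g [] = 0)
    (h : ∀ i, HasSum (fun v => g (i :: v)) (a i)) : HasSum g (∑ i, a i) := by
  let G : Fin N → List (Fin N) → E := fun i w => if w.head? = some i then g w else 0
  have hG : ∀ i, HasSum (G i) (a i) := by
    intro i
    rw [← Function.Injective.hasSum_iff (List.cons_injective (a := i))]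
    · have e : G i ∘ List.cons i = fun v => g (i :: v) := funext fun v => by simp [G]
      rw [e]
      exact h i
    · intro w hw
      refine if_neg fun hi => hw ?_
      obtain ⟨v, rfl⟩ := List.head?_eq_some_iff.1 hi
      exact ⟨v, rfl⟩
  have := hasSum_sum (s := Finset.univ) fun i _ => hG i
  have e : (fun w => ∑ i, G i w) = g := by
    funext w
    cases w with
    | nil => simp [G, h0]
    | cons k v => simp [G]
  rwa [e] at this

/-- The power series `∑_i Y_i ξ_i`. -/
def joinHead (ξ : Fin N → NCSeries N) : NCSeries N
  | [] => 0
  | i :: v => ξ i v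

theorem joinHead_cons (ξ : Fin N → NCSeries N) (i : Fin N) (v : List (Fin N)) :
    joinHead ξ (i :: v) = ξ i v := rfl

theorem summable_joinHead {R : ℝ} {ξ : Fin N → NCSeries N}
    (h : ∀ i, Summable fun w => ‖ξ i w‖ * R ^ w.length) :
    Summable fun w => ‖joinHead ξ w‖ * R ^ w.length := by
  refine (hasSum_list_cons (a := fun i => R * ∑' v, ‖ξ i v‖ * R ^ v.length) (by simp [joinHead])
    fun i => ?_).summable
  have e : (fun v => ‖joinHead ξ (i :: v)‖ * R ^ (i :: v).length) =
      fun v => R * (‖ξ i v‖ * R ^ v.length) := funext fun v => by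
    rw [joinHead_cons, List.length_cons, pow_succ']
    ring
  rw [e]
  exact (h i).hasSum.mul_left R

/-- The leading Y_i is absorbed into the test word, so the pairing for ξ_i applies at `u ++ [i]`. -/
theorem joinHead_pairing {R ρ : ℝ} (hρ : 0 < ρ) (Q : QMatrix N)
    (hR : ρ + ((1 - Q.maxAbs) * ρ)⁻¹ ≤ R) {ξ : Fin N → NCSeries N}
    (hξ : ∀ i, Summable fun w => ‖ξ i w‖ * R ^ w.length)
    (h : ∀ i u, ∑' w, ξ i w * moment Q (u ++ w) = diffMoment Q i u) (u : List (Fin N)) :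
    ∑' w, joinHead ξ w * moment Q (u ++ w) = ∑ i, diffMoment Q i (u ++ [i]) := by
  refine (hasSum_list_cons (by simp [joinHead]) fun i => ?_).tsum_eq
  rw [← h]
  have hs : Summable fun w => ξ i w * moment Q ((u ++ [i]) ++ w) :=
    summable_mul_of_le (C := R ^ (u ++ [i]).length) (hξ i) fun w => by
      rw [← pow_add, ← List.length_append]
      exact norm_moment_le hρ Q hR _
  convert hs.hasSum using 2 with v
  simp [joinHead]

/-- The cyclic potential of a system of power series: the coefficient of a word `i v` is that of
`v` in `ξ_i` divided by the length. -/
noncomputable def potential (ξ : Fin N → NCSeries N) : NCSeries N :=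
  fun w => (w.length : ℂ)⁻¹ * joinHead ξ w

theorem potential_selfAdjoint {ξ : Fin N → NCSeries N} (h : (joinHead ξ).SelfAdjoint) :
    (potential ξ).SelfAdjoint := by
  intro w
  rw [potential, potential, map_mul, h w, List.length_reverse, map_inv₀, Complex.conj_natCast]

/-- Self-adjointness of ∑ Y_i ξ_i and of each ξ_i gives ∑ Y_i ξ_i = ∑ ξ_i Y_i; this is the same
equality read on coefficients. -/
theorem joinHead_append_singleton {ξ : Fin N → NCSeries N} (h : (joinHead ξ).SelfAdjoint)
    (hξ : ∀ i, (ξ i).SelfAdjoint) (i : Fin N) (u : List (Fin N)) :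
    joinHead ξ (u ++ [i]) = ξ i u := by
  rw [← h, List.reverse_append]
  exact hξ i u

theorem joinHead_rotate {ξ : Fin N → NCSeries N} (h : (joinHead ξ).SelfAdjoint)
    (hξ : ∀ i, (ξ i).SelfAdjoint) (u v : List (Fin N)) :
    joinHead ξ (u ++ v) = joinHead ξ (v ++ u) := by
  induction u generalizing v with
  | nil => simp
  | cons i u ih =>
    have : v ++ i :: u = (v ++ [i]) ++ u := by simp
    rw [this, ← ih, ← List.append_assoc, joinHead_append_singleton h hξ]
    rfl

/-- The |u| + 1 words contributing to the coefficient of `u` are rotations of `i :: u`, so they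
carry equal coefficients, and the division by the length in `potential` makes them add up to one
copy. -/
theorem cyclicGradient_potential {ξ : Fin N → NCSeries N} (h : (joinHead ξ).SelfAdjoint)
    (hξ : ∀ i, (ξ i).SelfAdjoint) (i : Fin N) : (potential ξ).cyclicGradient i = ξ i := by
  funext u
  have h1 : ∀ k ∈ Finset.range (u.length + 1), potential ξ (u.drop k ++ i :: u.take k) =
      ((u.length + 1 : ℕ) : ℂ)⁻¹ * ξ i u := by
    intro k hk
    have hlen : (u.drop k ++ i :: u.take k).length = u.length + 1 := by
      simp at hk ⊢
      omega
    rw [potential, hlen, joinHead_rotate h hξ, List.cons_append, List.take_append_drop]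
    rfl
  rw [NCSeries.cyclicGradient, Finset.sum_congr rfl h1, Finset.sum_const, Finset.card_range,
    nsmul_eq_mul, mul_inv_cancel_left₀]
  exact Nat.cast_ne_zero.2 (Nat.succ_ne_zero u.length)

theorem summable_potential {R : ℝ} (hR : 0 ≤ R) {ξ : Fin N → NCSeries N}
    (h : Summable fun w => ‖joinHead ξ w‖ * R ^ w.length) :
    Summable fun w => ‖potential ξ w‖ * R ^ w.length := by
  refine Summable.of_nonneg_of_le (fun w => by positivity) (fun w => ?_) h
  rw [potential, norm_mul, norm_inv, Complex.norm_natCast]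
  gcongr
  exact mul_le_of_le_one_left (norm_nonneg _) (Nat.cast_inv_le_one _)

/-! ### Distance from the conjugate series to Y_j. -/

theorem wick_singleton (Q : QMatrix N) (j : Fin N) : wick Q (word [j]) = word [j] := by
  rw [← lcr_word, wick_lcr, wick_nil, lann_nil, map_zero, sub_zero]

/-- D_j kills Ω, and the vacuum coefficient of D_j e_k is δ_{jk}. In length at most 1 only `[j]`
contributes, and its term is exactly Y_j. -/
theorem conjSeries_sub_var {R : ℝ} (hR : 0 < R) (Q : QMatrix N)
    (hQ : Q.maxAbs * (1 - Q.maxAbs)⁻¹ < 1) {j : Fin N}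
    (hs : Summable fun v => wnorm R (conjTerm Q j v)) :
    conjSeries Q j - NCSeries.var j =
      superpose fun v => if v.length < 2 then 0 else conjTerm Q j v := by
  funext w
  have hw : Summable fun v => conjTerm Q j v w := by
    refine Summable.of_norm_bounded (hs.mul_left (R ^ w.length)⁻¹) fun v => ?_
    rw [inv_mul_eq_div, le_div_iff₀ (by positivity)]
    exact norm_apply_le_wnorm hR.le _ _
  have hj : conjTerm Q j [j] = word [j] := by
    rw [conjTerm, conjFunctional_singleton, if_pos rfl, map_one, one_smul,
      dualVec_singleton Q hQ, wick_singleton]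
  have hvar : NCSeries.var j w = (word [j] : NCPoly N) w := by
    rw [NCSeries.var, Finsupp.single_apply, Pi.single_apply]
    simp [eq_comm]
  rw [Pi.sub_apply, conjSeries, superpose, hw.tsum_eq_add_tsum_ite [j], hj, hvar,
    add_sub_cancel_left, superpose]
  refine tsum_congr fun v => ?_
  match v with
  | [] => simp [conjTerm, conjFunctional_nil]
  | [k] =>
    by_cases hk : k = j
    · simp [hk]
    · simp [hk, conjTerm, conjFunctional_singleton]
  | k :: l :: v => simp

theorem rNorm_conjSeries_sub_var_le {R α σ : ℝ} (hR : 0 < R) (hα : 0 < α) (hσ : 0 < σ)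
    (Q : QMatrix N)
    (hQ : Q.maxAbs * (1 - Q.maxAbs)⁻¹ < 1) (hRα : R + ((1 - Q.maxAbs) * α)⁻¹ ≤ α)
    (hQσ : Q.maxAbs * (1 - Q.maxAbs)⁻¹ ≤ σ ^ 2)
    (hN : N * (σ * ((1 - Q.maxAbs * (1 - Q.maxAbs)⁻¹)⁻¹ * α)) ≤ 1 / 2) (j : Fin N) :
    (conjSeries Q j - NCSeries.var j).rNorm R ≤
      ENNReal.ofReal (8 * (N * ((1 - Q.maxAbs * (1 - Q.maxAbs)⁻¹)⁻¹ * α)) ^ 2 * σ) := by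
  rw [conjSeries_sub_var hR Q hQ
    (summable_wnorm_conjTerm hR.le hα hσ Q hQ hRα hQσ (hN.trans_lt (by norm_num)) j)]
  refine (rNorm_superpose_le hR.le _).trans ?_
  set c := (1 - Q.maxAbs * (1 - Q.maxAbs)⁻¹)⁻¹ * α with hc
  have hc0 : 0 ≤ c := mul_nonneg (inv_nonneg.2 (sub_pos.2 hQ).le) hα.le
  let b : ℕ → ℝ := fun n => if n < 2 then 0 else σ⁻¹ * (n * (σ * c) ^ n)
  have h1 : ∀ v : List (Fin N), wnorm R (if v.length < 2 then 0 else conjTerm Q j v) ≤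
      b v.length := by
    intro v
    simp only [b]
    split_ifs
    · rw [wnorm_zero]
    · exact wnorm_conjTerm_le hR.le hα hσ Q hQ hRα hQσ j v
  -- For n ≥ 2, two factors Nσc are kept and the others bounded by 1/2. With σ⁻¹ this leaves (Nc)²σ,
  -- and 4 = 2² restores the exponent n. Since ∑ n 2⁻ⁿ = 2, the total constant is 8.
  have h2 : ∀ n, (N : ℝ) ^ n * b n ≤ 4 * (N * c) ^ 2 * σ * (n * (1 / 2) ^ n) := by
    intro n
    simp only [b]
    split_ifs with hn
    · rw [mul_zero]; positivity
    · obtain ⟨m, rfl⟩ : ∃ m, n = m + 2 := ⟨n - 2, by omega⟩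
      have h3 : (N * (σ * c)) ^ m ≤ (1 / 2 : ℝ) ^ m := pow_le_pow_left₀ (by positivity) hN m
      calc (N : ℝ) ^ (m + 2) * (σ⁻¹ * ((m + 2 : ℕ) * (σ * c) ^ (m + 2)))
          = (N * c) ^ 2 * σ * ((m + 2 : ℕ) * (N * (σ * c)) ^ m) := by
            rw [mul_pow (N : ℝ) (σ * c) m]
            field_simp
            ring
        _ ≤ (N * c) ^ 2 * σ * ((m + 2 : ℕ) * (1 / 2) ^ m) := by gcongr
        _ = _ := by rw [pow_add]; ring
  have h3 := hasSum_coe_mul_geometric_of_norm_lt_one (𝕜 := ℝ) (r := 1 / 2) (by norm_num)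
  have h4 := h3.mul_left (4 * (N * c) ^ 2 * σ)
  calc _ ≤ ∑' v : List (Fin N), ENNReal.ofReal (b v.length) :=
        ENNReal.tsum_le_tsum fun v => ENNReal.ofReal_le_ofReal (h1 v)
    _ = ∑' n, ENNReal.ofReal ((N : ℝ) ^ n * b n) := by
        rw [tsum_list_length (fun n => ENNReal.ofReal (b n))]
        refine tsum_congr fun n => ?_
        rw [ENNReal.ofReal_mul (by positivity), ENNReal.ofReal_pow (by positivity),
          ENNReal.ofReal_natCast]
    _ ≤ ∑' n : ℕ, ENNReal.ofReal (4 * (N * c) ^ 2 * σ * (n * (1 / 2) ^ n)) :=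
        ENNReal.tsum_le_tsum fun n => ENNReal.ofReal_le_ofReal (h2 n)
    _ = _ := by
        rw [← ENNReal.ofReal_tsum_of_nonneg (fun n => by positivity) h4.summable, h4.tsum_eq]
        congr 1
        ring

/-! ### From words to operators on the Fock space. -/

/-- The embedding of polynomials into the Fock space that sends words to basis tensors. -/
noncomputable def toFock (Q : QMatrix N) (x : NCPoly N) : Fock Q :=
  ((toPreFock Q x : PreFock Q) : Fock Q)

theorem inner_toFock (Q : QMatrix N) (x y : NCPoly N) :
    inner ℂ (toFock Q x) (toFock Q y) = form Q x y :=
  UniformSpace.Completion.inner_coe _ _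

theorem toFock_nil (Q : QMatrix N) : toFock Q (word []) = vacuum Q := by
  rw [toFock, toPreFock_word, vacuum]
  have : (⟨([] : List (Fin N)).length, ([] : List (Fin N)).get⟩ : FockIndex N) =
    ⟨0, Fin.elim0⟩ := Sigma.ext rfl (heq_of_eq (funext fun k => Fin.elim0 k))
  rw [this]

theorem gaussian_toFock (Q : QMatrix N) (i : Fin N) (x : NCPoly N) :
    gaussian Q i (toFock Q x) = toFock Q (field Q i x) := by
  rw [gaussian, add_apply, toFock, creation_coe, adjoint_creation_coe,
    ← toPreFock_lcr, ← toPreFock_lann, ← UniformSpace.Completion.coe_add, ← map_add]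
  rfl

theorem gaussian_prod_vacuum (Q : QMatrix N) (w : List (Fin N)) :
    (w.map (gaussian Q)).prod (vacuum Q) = toFock Q (toVector Q (word w)) := by
  induction w with
  | nil => rw [toVector_nil, toFock_nil]; rfl
  | cons i w ih =>
    rw [List.map_cons, List.prod_cons]
    change gaussian Q i ((w.map (gaussian Q)).prod (vacuum Q)) = _
    rw [ih, gaussian_toFock, toVector_cons]

theorem trace_gaussian_prod (Q : QMatrix N) (w : List (Fin N)) :
    trace Q (w.map (gaussian Q)).prod = moment Q w := by
  change inner ℂ (vacuum Q) ((w.map (gaussian Q)).prod (vacuum Q)) = _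
  rw [gaussian_prod_vacuum, ← toFock_nil, inner_toFock, form_nil_left]
  rfl

theorem polyEval_word (Q : QMatrix N) (w : List (Fin N)) :
    polyEval Q (word w) = (w.map (gaussian Q)).prod := by
  simp [polyEval]

theorem tensorTrace_freeDiff_word (Q : QMatrix N) (j : Fin N) (u : List (Fin N)) :
    tensorTrace Q (freeDiff j (word u)) = diffMoment Q j u := by
  have h : freeDiff j (word u) = ∑ k : Fin u.length,
      if u.get k = j then (word (u.take k) : NCPoly N) ⊗ₜ[ℂ] (word (u.drop (k + 1)) : NCPoly N)
      else 0 := by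
    simp [freeDiff]
  rw [h, map_sum, diffMoment]
  refine Finset.sum_congr rfl fun k _ => ?_
  split_ifs
  · simp only [tensorTrace, LinearMap.comp_apply, TensorProduct.map_tmul, polyEval_word,
      trace_gaussian_prod, LinearMap.mul'_apply]
  · exact map_zero _

theorem norm_creation_le (Q : QMatrix N) (i : Fin N) :
    ‖creation Q i‖ ≤ (1 - Q.maxAbs)⁻¹ := by
  have hq : 0 < 1 - Q.maxAbs := sub_pos.2 Q.maxAbs_lt_one
  have hqi : |Q.coef i i| ≤ Q.maxAbs := by
    simpa [QMatrix.entry] using Q.norm_entry_le i i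
  have h0 := Q.maxAbs_nonneg
  refine ContinuousLinearMap.opNorm_le_bound _ (by positivity) fun x => ?_
  refine UniformSpace.Completion.induction_on x
    (isClosed_le (by fun_prop) (by fun_prop)) fun y => ?_
  rw [creation_coe, UniformSpace.Completion.norm_coe, UniformSpace.Completion.norm_coe]
  refine (norm_create_le Q i y).trans (mul_le_mul_of_nonneg_right ?_ (norm_nonneg y))
  have h1 : (1 - |Q.coef i i|)⁻¹ ≤ (1 - Q.maxAbs)⁻¹ := inv_anti₀ hq (by linarith)
  have h2 : 1 ≤ (1 - Q.maxAbs)⁻¹ := (one_le_inv₀ hq).2 (by linarith)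
  rw [Real.sqrt_le_left (by positivity), sq]
  nlinarith

/-- A crude bound, enough because the radius is (2 + ε)/(1 - q). -/
theorem norm_gaussian_le (Q : QMatrix N) (i : Fin N) :
    ‖gaussian Q i‖ ≤ 2 * (1 - Q.maxAbs)⁻¹ := by
  have h := norm_creation_le Q i
  refine (norm_add_le _ _).trans ?_
  rw [LinearIsometryEquiv.norm_map]
  linarith

theorem norm_gaussian_prod_le {R : ℝ} (hR : 0 ≤ R) (Q : QMatrix N) (h : ∀ i, ‖gaussian Q i‖ ≤ R)
    (w : List (Fin N)) : ‖(w.map (gaussian Q)).prod‖ ≤ R ^ w.length := by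
  induction w with
  | nil =>
    rw [List.length_nil, pow_zero]
    exact ContinuousLinearMap.norm_id_le
  | cons i w ih =>
    rw [List.map_cons, List.prod_cons, List.length_cons, pow_succ']
    exact (norm_mul_le _ _).trans (mul_le_mul (h i) ih (norm_nonneg _) hR)

theorem hasSum_eval {R : ℝ} (hR : 0 ≤ R) (Q : QMatrix N) (h : ∀ i, ‖gaussian Q i‖ ≤ R)
    {F : NCSeries N} (hF : Summable fun w => ‖F w‖ * R ^ w.length) :
    HasSum (fun w => F w • (w.map (gaussian Q)).prod) (F.eval Q) := by
  refine Summable.hasSum (Summable.of_norm_bounded hF fun w => ?_)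
  rw [norm_smul]
  gcongr
  exact norm_gaussian_prod_le hR Q h w

/-- Commutation with the commutant passes to norm-convergent sums. -/
theorem eval_mem_gaussianAlgebra {R : ℝ} (hR : 0 ≤ R) (Q : QMatrix N)
    (h : ∀ i, ‖gaussian Q i‖ ≤ R)
    {F : NCSeries N} (hF : Summable fun w => ‖F w‖ * R ^ w.length) :
    F.eval Q ∈ gaussianAlgebra Q := by
  have hX : ∀ i, gaussian Q i ∈ gaussianAlgebra Q := by
    intro i
    change gaussian Q i ∈ StarSubalgebra.centralizer ℂ
      (StarSubalgebra.centralizer ℂ (Set.range (gaussian Q)) : Set (Fock Q →L[ℂ] Fock Q))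
    rw [← SetLike.mem_coe, StarSubalgebra.coe_centralizer_centralizer]
    exact Set.subset_centralizer_centralizer (Set.mem_union_left _ ⟨i, rfl⟩)
  have hw : ∀ w : List (Fin N), (w.map (gaussian Q)).prod ∈ gaussianAlgebra Q := by
    intro w
    induction w with
    | nil => exact one_mem _
    | cons i w ih =>
      rw [List.map_cons, List.prod_cons]
      exact mul_mem (hX i) ih
  have hs := hasSum_eval hR Q h hF
  rw [← SetLike.mem_coe, ← VonNeumannAlgebra.centralizer_centralizer]
  intro T hT
  have h1 := hs.mul_left T
  have h2 := hs.mul_right T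
  refine h1.unique (h2.congr_fun fun w => ?_)
  rw [smul_mul_assoc, mul_smul_comm, hT _ (hw w)]

/-- The conjugate comes from the inner product being conjugate linear in its first variable, the
reversal from the symmetry of the X_i. -/
theorem inner_eval_vacuum {R : ℝ} (hR : 0 ≤ R) (Q : QMatrix N)
    (h : ∀ i, ‖gaussian Q i‖ ≤ R)
    {F : NCSeries N} (hF : Summable fun w => ‖F w‖ * R ^ w.length) (u : List (Fin N)) :
    inner ℂ (F.eval Q (vacuum Q)) (polyEval Q (word u) (vacuum Q)) =
      conj (∑' w, F w * moment Q (u.reverse ++ w)) := by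
  have hs := (hasSum_eval hR Q h hF).mapL (ContinuousLinearMap.apply ℂ (Fock Q) (vacuum Q))
  have hs2 := hs.mapL (innerSL ℂ (polyEval Q (word u) (vacuum Q)))
  rw [← inner_conj_symm]
  congr 1
  refine Eq.trans hs2.tsum_eq.symm (tsum_congr fun w => ?_)
  simp only [ContinuousLinearMap.apply_apply, innerSL_apply_apply, smul_apply,
    inner_smul_right, polyEval_word, gaussian_prod_vacuum, inner_toFock, form_toVector_word]

theorem isConjugateSystem_of_pairing {R : ℝ} (hR : 0 ≤ R) (Q : QMatrix N)
    (h : ∀ i, ‖gaussian Q i‖ ≤ R) {ξ : Fin N → NCSeries N}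
    (hξ : ∀ i, Summable fun w => ‖ξ i w‖ * R ^ w.length)
    (hp : ∀ j u, ∑' w, ξ j w * moment Q (u ++ w) = diffMoment Q j u) :
    IsConjugateSystem Q fun i => (ξ i).eval Q := by
  refine fun j => ⟨eval_mem_gaussianAlgebra hR Q h (hξ j), fun P => ?_⟩
  induction P using Finsupp.induction_linear with
  | zero => simp
  | add P P' hP hP' =>
    rw [map_add, add_apply, inner_add_right, hP, hP', map_add, map_add]
  | single u c =>
    have : (Finsupp.single u c : NCPoly N) = c • word u := by simp
    rw [this, map_smul, smul_apply, inner_smul_right, map_smul, map_smul,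
      inner_eval_vacuum hR Q h (hξ j), hp, conj_diffMoment, List.reverse_reverse,
      tensorTrace_freeDiff_word, smul_eq_mul]

/-! ### Numerical consequences of admissibility. -/

theorem QMatrix.IsSmall.maxAbs_lt {ε : ℝ} (hε : 0 < ε) {Q : QMatrix N} (h : Q.IsSmall ε) :
    Q.maxAbs < 1 / 4 := by
  rcases Nat.eq_zero_or_pos N with rfl | hN
  · rw [QMatrix.maxAbs, Real.iSup_of_isEmpty]; norm_num
  · have h1 := h.1
    have h0 := Q.maxAbs_nonneg
    have hN' : (1 : ℝ) ≤ N := by exact_mod_cast hN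
    have h3 : 9 ≤ (3 + ε) ^ 2 * (N : ℝ) ^ 2 := by
      have : (3 : ℝ) ≤ (3 + ε) * N := by nlinarith
      rw [← mul_pow]
      nlinarith
    have h4 := Q.maxAbs_lt_one
    nlinarith

/-- Clearing the denominator in π < 1 and using 1 - 3q + 2q² = (1-q)(1-2q). -/
theorem QMatrix.IsSmall.two_mul_lt {ε : ℝ} {Q : QMatrix N} (h : Q.IsSmall ε) :
    2 * (Q.maxAbs * N ^ 2 * (3 + ε) ^ 2) < (1 - Q.maxAbs) * (1 - 2 * Q.maxAbs) := by
  have h2 := h.2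
  rw [piBound, div_lt_one (sub_pos.2 h.1)] at h2
  nlinarith

theorem one_sub_mul_inv_inv {q : ℝ} (h : q < 1) :
    (1 - q * (1 - q)⁻¹)⁻¹ = (1 - q) / (1 - 2 * q) := by
  have h1 : 1 - q ≠ 0 := (sub_pos.2 h).ne'
  rw [inv_eq_one_div, show 1 - q * (1 - q)⁻¹ = (1 - 2 * q) / (1 - q) by field_simp; ring,
    one_div_div]

theorem QMatrix.IsSmall.mul_inv_lt_one {ε : ℝ} (hε : 0 < ε) {Q : QMatrix N} (h : Q.IsSmall ε) :
    Q.maxAbs * (1 - Q.maxAbs)⁻¹ < 1 := by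
  have h1 := h.maxAbs_lt hε
  rw [← div_eq_mul_inv, div_lt_one (by linarith)]
  linarith

theorem radius_pos {ε q : ℝ} (hε : 0 < ε) (hq : q < 1) : 0 < radius ε q :=
  div_pos (by linarith) (sub_pos.2 hq)

/-- The radius at which the Wick polynomials of degree `n` have norm at most
`((3 + ε) / (1 - q)) ^ n`. -/
noncomputable def outerRadius (ε q : ℝ) : ℝ := (3 + ε) / (1 - q) - (3 + ε)⁻¹

theorem radius_lt_outerRadius {ε q : ℝ} (hε : 0 < ε) (hq : q < 1) (hq0 : 0 ≤ q) :
    radius ε q < outerRadius ε q := by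
  have h1 : 0 < 1 - q := sub_pos.2 hq
  have h2 : (3 + ε)⁻¹ < 1 := inv_lt_one_of_one_lt₀ (by linarith)
  have h3 : 1 ≤ (1 - q)⁻¹ := (one_le_inv₀ h1).2 (by linarith)
  have h4 : (3 + ε) / (1 - q) = (2 + ε) / (1 - q) + (1 - q)⁻¹ := by field_simp; ring
  rw [radius, outerRadius, h4]
  linarith

theorem outerRadius_add_inv {ε q : ℝ} (hq : q < 1) :
    outerRadius ε q + ((1 - q) * ((3 + ε) / (1 - q)))⁻¹ = (3 + ε) / (1 - q) := by
  rw [mul_div_cancel₀ _ (sub_pos.2 hq).ne', outerRadius, sub_add_cancel]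

theorem QMatrix.IsSmall.exists_rate {ε : ℝ} (hε : 0 < ε) {Q : QMatrix N} (h : Q.IsSmall ε) :
    ∃ σ > 0, Q.maxAbs * (1 - Q.maxAbs)⁻¹ ≤ σ ^ 2 ∧
      N * (σ * ((1 - Q.maxAbs * (1 - Q.maxAbs)⁻¹)⁻¹ * ((3 + ε) / (1 - Q.maxAbs)))) < 1 := by
  have hq := h.maxAbs_lt hε
  have hq0 := Q.maxAbs_nonneg
  have h2 := h.two_mul_lt
  set q := Q.maxAbs with hqdef
  have h1 : 0 < 1 - q := by linarith
  have h12 : 0 < 1 - 2 * q := by linarith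
  rw [one_sub_mul_inv_inv (by linarith), ← div_eq_mul_inv]
  have hc : (1 - q) / (1 - 2 * q) * ((3 + ε) / (1 - q)) = (3 + ε) / (1 - 2 * q) := by field_simp
  rw [hc]
  set c : ℝ := N * ((3 + ε) / (1 - 2 * q)) with hcdef
  have hc0 : 0 ≤ c := by positivity
  have hθ0 : 0 ≤ q / (1 - q) := by positivity
  -- `two_mul_lt` bounds q N² (3+ε)² by (1-q)(1-2q)/2, and q < 1/4 turns the 1/2 into the missing
  -- factor 1 - 2q.
  have key : c ^ 2 * (q / (1 - q)) < 1 := by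
    have e : c ^ 2 * (q / (1 - q)) = (q * N ^ 2 * (3 + ε) ^ 2) / ((1 - q) * (1 - 2 * q) ^ 2) := by
      rw [hcdef]; field_simp
    rw [e, div_lt_one (by positivity)]
    nlinarith [mul_pos h1 h12, mul_pos (mul_pos h1 h12) h12]
  have hgap : 0 < 1 - c ^ 2 * (q / (1 - q)) := sub_pos.2 key
  -- A value for σ² strictly above q/(1-q), so positive even when q = 0, with c²σ² still below 1.
  -- The denominator c² + 1 also covers c = 0, that is N = 0.
  set s := q / (1 - q) + (1 - c ^ 2 * (q / (1 - q))) / (c ^ 2 + 1) with hs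
  have hs0 : 0 < s := by positivity
  have hcs : c ^ 2 * s < 1 := by
    have : c ^ 2 * s = c ^ 2 * (q / (1 - q)) +
        (1 - c ^ 2 * (q / (1 - q))) * (c ^ 2 / (c ^ 2 + 1)) := by rw [hs]; ring
    have h3 : c ^ 2 / (c ^ 2 + 1) < 1 := by rw [div_lt_one (by positivity)]; linarith
    nlinarith
  refine ⟨√s, Real.sqrt_pos.2 hs0, ?_, ?_⟩
  · rw [Real.sq_sqrt hs0.le, hs]
    have : 0 < (1 - c ^ 2 * (q / (1 - q))) / (c ^ 2 + 1) := by positivity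
    linarith
  · have e : N * (√s * ((3 + ε) / (1 - 2 * q))) = c * √s := by rw [hcdef]; ring
    rw [e]
    have h4 : (c * √s) ^ 2 < 1 := by rwa [mul_pow, Real.sq_sqrt hs0.le]
    nlinarith [mul_nonneg hc0 (Real.sqrt_nonneg s)]

/-! ### Assembling the three assertions. -/

theorem QMatrix.IsSmall.conjSeries_spec {ε : ℝ} (hε : 0 < ε) {Q : QMatrix N} (h : Q.IsSmall ε) :
    (∀ i, ‖gaussian Q i‖ < radius ε Q.maxAbs) ∧
      (∀ i, (conjSeries Q i).RadiusGT (radius ε Q.maxAbs)) ∧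
      IsConjugateSystem Q (fun i => (conjSeries Q i).eval Q) ∧
      ∃ V : NCSeries N, V.RadiusGT (radius ε Q.maxAbs) ∧ V.SelfAdjoint ∧
        ∀ i, V.cyclicGradient i = conjSeries Q i := by
  have hq1 := Q.maxAbs_lt_one
  have hq0 := Q.maxAbs_nonneg
  have h1 : 0 < 1 - Q.maxAbs := sub_pos.2 hq1
  have hθ := h.mul_inv_lt_one hε
  have hR := radius_pos hε hq1
  have hRR' := radius_lt_outerRadius hε hq1 hq0
  have hR' : 0 ≤ outerRadius ε Q.maxAbs := (hR.trans hRR').le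
  have hα : 0 < (3 + ε) / (1 - Q.maxAbs) := by positivity
  obtain ⟨σ, hσ, hσ1, hσ2⟩ := h.exists_rate hε
  have hX : ∀ i, ‖gaussian Q i‖ < radius ε Q.maxAbs := fun i =>
    (norm_gaussian_le Q i).trans_lt (by
      rw [radius, div_eq_mul_inv]
      exact mul_lt_mul_of_pos_right (by linarith) (inv_pos.2 h1))
  have hX' : ∀ i, ‖gaussian Q i‖ ≤ outerRadius ε Q.maxAbs := fun i => ((hX i).trans hRR').le
  have hs : ∀ i, Summable fun v => wnorm (outerRadius ε Q.maxAbs) (conjTerm Q i v) :=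
    summable_wnorm_conjTerm hR' hα hσ Q hθ (outerRadius_add_inv hq1).le hσ1 hσ2
  have hξtop : ∀ i, (conjSeries Q i).rNorm (outerRadius ε Q.maxAbs) < ∞ := fun i =>
    rNorm_lt_top_of_summable hR' (hs i)
  have hξ := fun i => (NCSeries.rNorm_lt_top_iff hR' _).1 (hξtop i)
  -- The intermediate radius ρ = (1+ε)/(1-q) of the uniqueness argument: (1-q)ρ = 1 + ε, so each
  -- annihilation costs less than 1, and ρ + (1+ε)⁻¹ stays below R.
  have hρ : 0 < (1 + ε) / (1 - Q.maxAbs) := by positivity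
  have hρi : ((1 - Q.maxAbs) * ((1 + ε) / (1 - Q.maxAbs)))⁻¹ = (1 + ε)⁻¹ := by
    rw [mul_div_cancel₀ _ h1.ne']
  have hinv : (1 + ε)⁻¹ < 1 := inv_lt_one_of_one_lt₀ (by linarith)
  have hinv1 : 1 ≤ (1 - Q.maxAbs)⁻¹ := (one_le_inv₀ h1).2 (by linarith)
  have hρR : (1 + ε) / (1 - Q.maxAbs) +
      ((1 - Q.maxAbs) * ((1 + ε) / (1 - Q.maxAbs)))⁻¹ ≤ outerRadius ε Q.maxAbs := by
    refine le_trans ?_ hRR'.le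
    have e : radius ε Q.maxAbs = (1 + ε) / (1 - Q.maxAbs) + (1 - Q.maxAbs)⁻¹ := by
      rw [radius]; field_simp; ring
    rw [hρi, e]
    linarith
  have hr : 0 < (1 + ε) / (1 - Q.maxAbs) - (1 + ε)⁻¹ := by
    rw [div_eq_mul_inv]
    nlinarith
  have hrρ : (1 + ε) / (1 - Q.maxAbs) - (1 + ε)⁻¹ +
      ((1 - Q.maxAbs) * ((1 + ε) / (1 - Q.maxAbs)))⁻¹ ≤ (1 + ε) / (1 - Q.maxAbs) := by
    rw [hρi, sub_add_cancel]
  have hp : ∀ j u, ∑' w, conjSeries Q j w * moment Q (u ++ w) = diffMoment Q j u := fun j =>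
    conjSeries_pairing hρ Q hθ hρR (hs j)
  have hξsa : ∀ i, (conjSeries Q i).SelfAdjoint := fun i =>
    selfAdjoint_of_pairing hr hρ Q hθ hρR hrρ (hξ i) (conj_diffMoment Q i) (hp i)
  have hj := summable_joinHead hξ
  have hjsa : (joinHead (conjSeries Q)).SelfAdjoint := by
    refine selfAdjoint_of_pairing hr hρ Q hθ hρR hrρ hj (fun u => ?_)
      (joinHead_pairing hρ Q hρR hξ hp)
    rw [map_sum, ← sum_diffMoment_cons]
    simp only [conj_diffMoment, List.reverse_append, List.reverse_cons, List.reverse_nil,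
      List.nil_append, List.cons_append]
  refine ⟨hX, fun i => ⟨_, hRR', hξtop i⟩, isConjugateSystem_of_pairing hR' Q hX' hξ hp,
    potential (conjSeries Q), ⟨_, hRR', ?_⟩, potential_selfAdjoint hjsa,
    cyclicGradient_potential hjsa hξsa⟩
  exact (NCSeries.rNorm_lt_top_iff hR' _).2 (summable_potential hR' hj)

theorem exists_forall_rNorm_conjSeries_sub_var_lt (N : ℕ) {ε : ℝ} (hε : 0 < ε) {η : ℝ}
    (hη : 0 < η) : ∃ δ > (0 : ℝ), ∀ Q : QMatrix N, Q.IsSmall ε → Q.maxAbs < δ →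
      ∀ i, (conjSeries Q i - NCSeries.var i).rNorm (radius ε Q.maxAbs) < ENNReal.ofReal η := by
  -- K dominates N(3+ε)/(1-2q) for all admissible Q because q < 1/4; the summand 1 keeps it positive
  -- when N = 0.
  set K : ℝ := 2 * N * (3 + ε) + 1 with hK
  have hK0 : 0 < K := by positivity
  -- The first bound makes the geometric ratio at most 1/2, the second makes the error 8K²σ at most
  -- η/2.
  set σ : ℝ := min (1 / (2 * K)) (η / (16 * K ^ 2)) with hσdef
  have hσ : 0 < σ := lt_min (by positivity) (by positivity)
  -- As 1 - q ≥ 1/2, q < σ²/2 forces q/(1-q) ≤ σ².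
  refine ⟨σ ^ 2 / 2, by positivity, fun Q h hδ i => ?_⟩
  have hq1 := Q.maxAbs_lt_one
  have hq0 := Q.maxAbs_nonneg
  have hq4 := h.maxAbs_lt hε
  have h1 : 0 < 1 - Q.maxAbs := sub_pos.2 hq1
  have h12 : 0 < 1 - 2 * Q.maxAbs := by linarith
  have hα : 0 < (3 + ε) / (1 - Q.maxAbs) := by positivity
  have hθ := h.mul_inv_lt_one hε
  have hc : N * ((1 - Q.maxAbs * (1 - Q.maxAbs)⁻¹)⁻¹ * ((3 + ε) / (1 - Q.maxAbs))) ≤ K := by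
    have e : (1 - Q.maxAbs) / (1 - 2 * Q.maxAbs) * ((3 + ε) / (1 - Q.maxAbs)) =
        (3 + ε) / (1 - 2 * Q.maxAbs) := by field_simp
    have h2 : (3 + ε) / (1 - 2 * Q.maxAbs) ≤ 2 * (3 + ε) := by
      rw [div_le_iff₀ h12]
      nlinarith
    rw [one_sub_mul_inv_inv hq1, e, hK]
    calc (N : ℝ) * ((3 + ε) / (1 - 2 * Q.maxAbs)) ≤ N * (2 * (3 + ε)) := by gcongr
      _ ≤ _ := by linarith
  have hc0 : 0 ≤ N * ((1 - Q.maxAbs * (1 - Q.maxAbs)⁻¹)⁻¹ * ((3 + ε) / (1 - Q.maxAbs))) :=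
    mul_nonneg (Nat.cast_nonneg N)
      (mul_nonneg (inv_nonneg.2 (sub_pos.2 hθ).le) hα.le)
  have hσK : K * σ ≤ 1 / 2 := by
    calc K * σ ≤ K * (1 / (2 * K)) := by gcongr; exact min_le_left _ _
      _ = 1 / 2 := by field_simp
  refine (rNorm_conjSeries_sub_var_le (radius_pos hε hq1) hα hσ Q hθ ?_ ?_ ?_ i).trans_lt ?_
  · refine le_trans ?_ (outerRadius_add_inv hq1).le
    have := radius_lt_outerRadius hε hq1 hq0
    gcongr
  · rw [← div_eq_mul_inv, div_le_iff₀ h1]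
    nlinarith [sq_nonneg σ]
  · rw [mul_left_comm, mul_comm σ]
    exact (mul_le_mul_of_nonneg_right hc hσ.le).trans hσK
  · refine (ENNReal.ofReal_lt_ofReal_iff hη).2 ?_
    calc _ ≤ 8 * K ^ 2 * (η / (16 * K ^ 2)) := by gcongr; exact min_le_right _ _
      _ = η / 2 := by field_simp; norm_num
      _ < η := by linarith

end MixedQ

theorem proposition4p1 (N : ℕ) (ε : ℝ) (hε : 0 < ε) :
    ∃ ξ : MixedQ.QMatrix N → Fin N → MixedQ.NCSeries N,
      (∀ Q : MixedQ.QMatrix N, Q.IsSmall ε →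
        (∀ i, ‖MixedQ.gaussian Q i‖ < MixedQ.radius ε Q.maxAbs) ∧
        (∀ i, (ξ Q i).RadiusGT (MixedQ.radius ε Q.maxAbs)) ∧
        MixedQ.IsConjugateSystem Q (fun i => (ξ Q i).eval Q) ∧
        ∃ V : MixedQ.NCSeries N,
          V.RadiusGT (MixedQ.radius ε Q.maxAbs) ∧ V.SelfAdjoint ∧
          ∀ i, V.cyclicGradient i = ξ Q i) ∧
      (∀ η > (0 : ℝ), ∃ δ > (0 : ℝ), ∀ Q : MixedQ.QMatrix N, Q.IsSmall ε → Q.maxAbs < δ →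
        ∀ i, (ξ Q i - MixedQ.NCSeries.var i).rNorm (MixedQ.radius ε Q.maxAbs) <
          ENNReal.ofReal η) := by
  refine ⟨MixedQ.conjSeries, fun Q hQ => ?_, fun η hη => ?_⟩
  · exact hQ.conjSeries_spec hε
  · exact MixedQ.exists_forall_rNorm_conjSeries_sub_var_lt N hε hη
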